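/- \textbf{Notation.} For $m\in\mathbb{Z}_+$ let $\ell_m$ be the set of all sequences $u:\mathbb{Z}_+\to\mathbb{R}^m$ ($\mathbb{Z}_+=\{0,1,2,\dots\}$) and $\ell^2_m\subset\ell_m$ the real Hilbert space of those with $\|u\|^2=\sum_{t\ge0}|u(t)|^2<\infty$. A (discrete-time) \emph{system} with input dimension $k$ and output dimension $q$ is a subset $\Delta\subset\ell_k\times\ell_q$. A prime denotes the Hermitian conjugate, and $\mathbb{T}=\{z\in\mathbb{C}:|z|=1\}$. The system $\Delta$ is \emph{weakly causally stable} if for every $T\in\mathbb{Z}_+$, $(v,w)\in\Delta$ and $v_*\in\ell^2_k$ with $v_*(t)=v(t)$ for all $t\le T$ there is a sequence $(v_i,w_i)\in\Delta\cap(\ell^2_k\times\ell^2_q)$ such that $v_i(t)=v(t)$ and $w_i(t)=w(t)$ for all $t\le T$ and all $i$, and $\|v_i-v_*\|\to0$ as $i\to\infty$. Let $A\in\mathbb{R}^{n\times n}$, $B_1\in\mathbb{R}^{n\times k}$, $B_2\in\mathbb{R}^{n\times q}$, $Q\in\mathbb{R}^{(n+k+q)\times(n+k+q)}$, where $A$ is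 a Schur matrix ($zI-A$ is nonsingular for all $z\in\mathbb{C}$ with $|z|\ge1$), let $X_0\subset\mathbb{R}^n$, and put $$\sigma(x,v,w)=\begin{bmatrix}x\\v\\w\end{bmatrix}'Q\begin{bmatrix}x\\v\\w\end{bmatrix},\qquad x(t+1)=Ax(t)+B_1v(t)+B_2w(t),\quad x(0)=x_0.\tag{1}$$ $\Delta$ satisfies the \emph{conditional IQC} defined by $A,B_1,B_2,Q,X_0$ if there is a continuous $\kappa:\mathbb{R}^n\times\mathbb{R}^k\times\mathbb{R}^q\to\mathbb{R}$ such that $\sum_{t=0}^\infty\sigma(x(t),v(t),w(t))\ge-\kappa(x_0,v(0),w(0))$ for all $(v,w)\in\Delta\cap(\ell^2_k\times\ell^2_q)$ and $x_0\in X_0$, with $x$ given by (1). $\Delta$ satisfies the \emph{complete IQC} defined by $A,B_1,B_2,Q,X_0$ if there is a continuous $\kappa:\mathbb{R}^n\times\mathbb{R}^k\times\mathbb{R}^q\to\mathbb{R}$ such that $\sum_{t=0}^T\sigma(x(t),v(t),w(t))\ge-\kappa(x_0,v(0),w(0))$ for all $T\in\mathbb{Z}_+$, all $(v,w)\in\Delta$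 and all $x_0\in X_0$, with $x$ given by (1). Let $B=[B_1,\ B_2]$ and $$\Pi(z)=\begin{bmatrix}(zI-A)^{-1}B\\ I\end{bmatrix}'Q\begin{bmatrix}(zI-A)^{-1}B\\ I\end{bmatrix}=\begin{bmatrix}\Pi_{11}(z)&\Pi_{12}(z)\\ \Pi_{21}(z)&\Pi_{22}(z)\end{bmatrix},\quad \Pi_{11}(z)\in\mathbb{C}^{k\times k},\ \Pi_{22}(z)\in\mathbb{C}^{q\times q}.$$ \textbf{Theorem.} Let $\Delta\subset\ell_k\times\ell_q$ be a weakly causally stable system which satisfies the conditional IQC defined by real matrices $A,B_1,B_2,Q$ of the above sizes, where $A$ is a Schur matrix, and a subset $X_0\subset\mathbb{R}^n$. Assume that (a) there exist $\varepsilon>0$ and $z_0\in\mathbb{T}$ such that $$\begin{bmatrix}\Pi_{11}(z)&\varepsilon\Pi_{12}(z)\\ \varepsilon\Pi_{21}(z)&-\Pi_{22}(z)\end{bmatrix}\ge0\quad\forall z\in\mathbb{T},\qquad \Pi_{11}(z_0)>0,\quad \Pi_{22}(z_0)<0,$$ where the inequalities mean that the matrix is Hermitian and positive semidefinite, positive definite,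 respectively negative definite; (b) there exist $C\in\mathbb{R}^{k\times n}$, $D_1\in\mathbb{R}^{k\times k}$, $D_2\in\mathbb{R}^{k\times q}$ such that $$\sigma(x,v,w)\le|Cx+D_1v+D_2w|^2\quad\forall x\in\mathbb{R}^n,\ v\in\mathbb{R}^k,\ w\in\mathbb{R}^q,$$ $$\det\begin{bmatrix}\lambda A-I&\lambda B_1\\ C&D_1\end{bmatrix}\ne0\quad\forall\lambda\in\mathbb{C},\ |\lambda|<1.$$ Then $\Delta$ satisfies the complete IQC defined by $A,B_1,B_2,Q,X_0$. -/

import Mathlib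

open Filter Topology Matrix
open scoped ComplexOrder

noncomputable section

namespace DTIQC

/-- Arbitrary one-sided sequences of vectors of `ℝᵐ` (with the Euclidean norm). -/
abbrev Signal (m : ℕ) : Type := ℕ → EuclideanSpace ℝ (Fin m)

/-- The real Hilbert space of square summable one-sided sequences of vectors of `ℝᵐ`. -/
abbrev SqSumSignal (m : ℕ) : Type := lp (fun _ : ℕ => EuclideanSpace ℝ (Fin m)) 2

/-- A discrete-time system with `k`-dimensional input and `q`-dimensional output is a set of
input/output pairs of signals. -/
abbrev DTSystem (k q : ℕ) : Type := Set (Signal k × Signal q)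

/-- The entrywise inclusion of real matrices into complex ones. -/
def toC {ι κ : Type*} (M : Matrix ι κ ℝ) : Matrix ι κ ℂ := M.map (fun r : ℝ => (r : ℂ))

/-- A real square matrix is Schur if `zI - A` is nonsingular for all complex `|z| ≥ 1`. -/
def IsSchur {n : ℕ} (A : Matrix (Fin n) (Fin n) ℝ) : Prop :=
  ∀ z : ℂ, 1 ≤ ‖z‖ → (z • (1 : Matrix (Fin n) (Fin n) ℂ) - toC A).det ≠ 0

/-- The system is weakly causally stable: any `(v, w)` in it, cut at any time `T`, can be
continued by square summable elements of the system whose inputs approach, in the norm of `ℓ²`, an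
arbitrary prescribed square summable continuation `vs` of the input. -/
def WeaklyCausallyStable {k q : ℕ} (Δ : DTSystem k q) : Prop :=
  ∀ (T : ℕ) (v : Signal k) (w : Signal q), (v, w) ∈ Δ →
    ∀ vs : SqSumSignal k, (∀ t ≤ T, v t = vs t) →
      ∃ (vi : ℕ → SqSumSignal k) (wi : ℕ → SqSumSignal q),
        (∀ i, ((vi i : Signal k), (wi i : Signal q)) ∈ Δ) ∧
        (∀ i, ∀ t ≤ T, vi i t = v t ∧ wi i t = w t) ∧
        Tendsto (fun i => ‖vi i - vs‖) atTop (𝓝 0)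

/-- `x` solves `x(t+1) = A x(t) + B₁ v(t) + B₂ w(t)`, `x(0) = x₀`. -/
def IsTrajectory {n k q : ℕ} (A : Matrix (Fin n) (Fin n) ℝ) (B₁ : Matrix (Fin n) (Fin k) ℝ)
    (B₂ : Matrix (Fin n) (Fin q) ℝ) (x₀ : EuclideanSpace ℝ (Fin n))
    (v : Signal k) (w : Signal q) (x : Signal n) : Prop :=
  x 0 = x₀ ∧
    ∀ t, x (t + 1) =
      WithLp.toLp 2 (A *ᵥ (x t).ofLp + B₁ *ᵥ (v t).ofLp + B₂ *ᵥ (w t).ofLp)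

/-- The quadratic form `σ(x, v, w) = [x; v; w]' Q [x; v; w]`. -/
def quadForm {n k q : ℕ} (Q : Matrix (Fin n ⊕ (Fin k ⊕ Fin q)) (Fin n ⊕ (Fin k ⊕ Fin q)) ℝ)
    (x : EuclideanSpace ℝ (Fin n)) (v : EuclideanSpace ℝ (Fin k))
    (w : EuclideanSpace ℝ (Fin q)) : ℝ :=
  Sum.elim x.ofLp (Sum.elim v.ofLp w.ofLp) ⬝ᵥ
    (Q *ᵥ Sum.elim x.ofLp (Sum.elim v.ofLp w.ofLp))

/-- The conditional IQC. It is used for Schur `A` only, where `x` is square summable whenever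
`v` and `w` are, so that the series converges absolutely. -/
def ConditionalIQC {n k q : ℕ} (Δ : DTSystem k q)
    (A : Matrix (Fin n) (Fin n) ℝ) (B₁ : Matrix (Fin n) (Fin k) ℝ)
    (B₂ : Matrix (Fin n) (Fin q) ℝ)
    (Q : Matrix (Fin n ⊕ (Fin k ⊕ Fin q)) (Fin n ⊕ (Fin k ⊕ Fin q)) ℝ)
    (X₀ : Set (EuclideanSpace ℝ (Fin n))) : Prop :=
  ∃ κ : EuclideanSpace ℝ (Fin n) × EuclideanSpace ℝ (Fin k) × EuclideanSpace ℝ (Fin q) → ℝ,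
    Continuous κ ∧
    ∀ (v : SqSumSignal k) (w : SqSumSignal q), ((v : Signal k), (w : Signal q)) ∈ Δ →
      ∀ x₀ ∈ X₀, ∀ x : Signal n, IsTrajectory A B₁ B₂ x₀ v w x →
        ∑' t, quadForm Q (x t) (v t) (w t) ≥ -κ (x₀, v 0, w 0)

/-- The complete IQC: a bound for all finite horizons and all elements of the system. -/
def CompleteIQC {n k q : ℕ} (Δ : DTSystem k q)
    (A : Matrix (Fin n) (Fin n) ℝ) (B₁ : Matrix (Fin n) (Fin k) ℝ)
    (B₂ : Matrix (Fin n) (Fin q) ℝ)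
    (Q : Matrix (Fin n ⊕ (Fin k ⊕ Fin q)) (Fin n ⊕ (Fin k ⊕ Fin q)) ℝ)
    (X₀ : Set (EuclideanSpace ℝ (Fin n))) : Prop :=
  ∃ κ : EuclideanSpace ℝ (Fin n) × EuclideanSpace ℝ (Fin k) × EuclideanSpace ℝ (Fin q) → ℝ,
    Continuous κ ∧
    ∀ (v : Signal k) (w : Signal q), (v, w) ∈ Δ →
      ∀ x₀ ∈ X₀, ∀ x : Signal n, IsTrajectory A B₁ B₂ x₀ v w x →
        ∀ T : ℕ, ∑ t ∈ Finset.range (T + 1), quadForm Q (x t) (v t) (w t) ≥ -κ (x₀, v 0, w 0)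

/-- `Π(z) = [(zI - A)⁻¹B; I]' Q [(zI - A)⁻¹B; I]` with `B = [B₁, B₂]`; the prime is the Hermitian
conjugate. For Schur `A` the inverse exists at all `|z| ≥ 1`. -/
def freqMatrix {n k q : ℕ} (A : Matrix (Fin n) (Fin n) ℝ) (B₁ : Matrix (Fin n) (Fin k) ℝ)
    (B₂ : Matrix (Fin n) (Fin q) ℝ)
    (Q : Matrix (Fin n ⊕ (Fin k ⊕ Fin q)) (Fin n ⊕ (Fin k ⊕ Fin q)) ℝ) (z : ℂ) :
    Matrix (Fin k ⊕ Fin q) (Fin k ⊕ Fin q) ℂ :=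
  let F : Matrix (Fin n ⊕ (Fin k ⊕ Fin q)) (Fin k ⊕ Fin q) ℂ :=
    fromRows ((z • (1 : Matrix (Fin n) (Fin n) ℂ) - toC A)⁻¹ * toC (fromCols B₁ B₂)) 1
  Fᴴ * toC Q * F

/-- The minimax frequency condition, for given `ε` and `z₀`. -/
def MinimaxFrequencyCondition {n k q : ℕ} (A : Matrix (Fin n) (Fin n) ℝ)
    (B₁ : Matrix (Fin n) (Fin k) ℝ) (B₂ : Matrix (Fin n) (Fin q) ℝ)
    (Q : Matrix (Fin n ⊕ (Fin k ⊕ Fin q)) (Fin n ⊕ (Fin k ⊕ Fin q)) ℝ)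
    (ε : ℝ) (z₀ : ℂ) : Prop :=
  (∀ z : ℂ, ‖z‖ = 1 →
    (fromBlocks (freqMatrix A B₁ B₂ Q z).toBlocks₁₁
      ((ε : ℂ) • (freqMatrix A B₁ B₂ Q z).toBlocks₁₂)
      ((ε : ℂ) • (freqMatrix A B₁ B₂ Q z).toBlocks₂₁)
      (-(freqMatrix A B₁ B₂ Q z).toBlocks₂₂)).PosSemidef) ∧
  (freqMatrix A B₁ B₂ Q z₀).toBlocks₁₁.PosDef ∧
  (-(freqMatrix A B₁ B₂ Q z₀).toBlocks₂₂).PosDef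

/-- `det [[λA - I, λB₁], [C, D₁]] ≠ 0` for all complex `|λ| < 1`. -/
def MinimumPhase {n k : ℕ} (A : Matrix (Fin n) (Fin n) ℝ) (B₁ : Matrix (Fin n) (Fin k) ℝ)
    (C : Matrix (Fin k) (Fin n) ℝ) (D₁ : Matrix (Fin k) (Fin k) ℝ) : Prop :=
  ∀ l : ℂ, ‖l‖ < 1 →
    (fromBlocks (l • toC A - 1) (l • toC B₁) (toC C) (toC D₁)).det ≠ 0

end DTIQC

end

/-! Fix an element `(v, w)` of the system, a horizon `T` and `δ > 0`. Suppose that from the state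
`x(T+1)` there is a square summable continuation `v₀` of the input for which the cost of the future
is at most `δ` for every square summable `w`, and likewise for all inputs near `v₀`. Weak causal
stability gives square summable elements of the system that agree with `(v, w)` up to `T` and whose
later inputs approach `v₀`. The conditional IQC bounds their total cost below by `-κ`; subtracting a
tail of at most `δ` and letting `δ → 0` gives the complete IQC with the same `κ`.

The continuation comes from a minimax argument (`exists_robust_input`). The future cost is a
quadratic function `Θ(y₀ + L₁ v + L₂ w)`, where `y₀` is the free response of the state. Condition
(b) makes its infimum over `v` nonpositive for each `w`: the minimum phase property lets `v` drive
`Cx + D₁v + D₂w` arbitrarily close to zero (`exists_cost_le`). Condition (a) makes the function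
convex in `v` and concave in `w`, with a cross term bounded by `1/ε` times the product of the two
seminorms. An approximate saddle point then exchanges inf and sup (`exists_forall_quadratic_le`); it
is found by a Lax-Milgram argument in the completion.

The delicate point is that `Π₁₁` and `Π₂₂` may degenerate on the circle, so the seminorms are not
equivalent to the `ℓ²` norms, yet the linear terms coming from `y₀` must be bounded by them.
Definiteness at one frequency gives a lower bound `c|p|²` with a polynomial `p` free of zeros in the
open disc (`exists_outer_lower_bound`). Every free response `Aᵗξ` lies in the range of the adjoint
of `p(S)`, `S` being the shift (`exists_freeResponse_eq_adjoint`), and moving `p(S)` to the other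
side gives the bound (`exists_bound_of_posSemidef`).

Frequency and time domains are linked through polynomials in the shift, with `λ = z⁻¹`. For finitely
supported signals Parseval's identity is an average over roots of unity, and density does the rest.
-/

namespace DTIQC

open Polynomial

/-! ### The shift on the scalar sequence space -/

/-- The complex Hilbert space of square summable one-sided scalar sequences. -/
abbrev SeqHilbert : Type := lp (fun _ : ℕ => ℂ) 2

theorem memℓp_two_iff {E : Type*} [NormedAddCommGroup E] (f : ℕ → E) :
    Memℓp f 2 ↔ Summable fun t => ‖f t‖ ^ 2 := by
  rw [memℓp_gen_iff (by norm_num)]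
  simp

theorem hasSum_norm_sq {E : Type*} [NormedAddCommGroup E] (f : lp (fun _ : ℕ => E) 2) :
    HasSum (fun t => ‖f t‖ ^ 2) (‖f‖ ^ 2) := by
  have h := lp.hasSum_norm (p := 2) (by norm_num) f
  simpa using h

theorem memℓp_natCases (u : SeqHilbert) :
    Memℓp (E := fun _ : ℕ => ℂ) (fun t => Nat.casesOn t 0 (fun s => u s)) 2 := by
  rw [memℓp_two_iff, ← summable_nat_add_iff 1]
  exact (hasSum_norm_sq u).summable

theorem seqHilbert_sum_apply {ι : Type*} (s : Finset ι) (f : ι → SeqHilbert) (t : ℕ) :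
    (∑ i ∈ s, f i) t = ∑ i ∈ s, f i t :=
  map_sum (lp.evalₗ (𝕜 := ℂ) (fun _ : ℕ => ℂ) 2 t) f s

/-- The forward shift. -/
noncomputable def shift : SeqHilbert →L[ℂ] SeqHilbert :=
  LinearMap.mkContinuous
    { toFun := fun u => ⟨_, memℓp_natCases u⟩
      map_add' := fun u v => by
        ext t
        cases t with
        | zero => exact (add_zero (0 : ℂ)).symm
        | succ t => rfl
      map_smul' := fun c u => by
        ext t
        cases t with
        | zero => exact (mul_zero c).symm
        | succ t => rfl } 1 (fun u => by
    rw [one_mul]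
    refine le_of_sq_le_sq ?_ (norm_nonneg u)
    refine le_of_eq ?_
    rw [← (hasSum_norm_sq u).tsum_eq, ← (hasSum_norm_sq _).tsum_eq,
      (hasSum_norm_sq _).summable.tsum_eq_zero_add]
    simp)

@[simp] theorem shift_zero (u : SeqHilbert) : shift u 0 = 0 := rfl

@[simp] theorem shift_succ (u : SeqHilbert) (t : ℕ) : shift u (t + 1) = u t := rfl

theorem norm_shift_le : ‖shift‖ ≤ 1 := LinearMap.mkContinuous_norm_le _ zero_le_one _

/-- The unit impulse at time `0`. -/
noncomputable def impulse : SeqHilbert := lp.single 2 0 1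

theorem shift_single (t : ℕ) (c : ℂ) :
    shift (lp.single 2 t c) = lp.single 2 (t + 1) c := by
  ext s
  cases s with
  | zero => simp
  | succ s => simp [Pi.single_apply]

theorem adjoint_shift_apply (u : SeqHilbert) (t : ℕ) :
    (ContinuousLinearMap.adjoint shift u) t = u (t + 1) := by
  have h1 := lp.inner_single_left (𝕜 := ℂ) (G := fun _ : ℕ => ℂ) t 1
    (ContinuousLinearMap.adjoint shift u)
  have h2 := lp.inner_single_left (𝕜 := ℂ) (G := fun _ : ℕ => ℂ) (t + 1) 1 u
  rw [ContinuousLinearMap.adjoint_inner_right, shift_single, h2] at h1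
  simpa using h1.symm

theorem aeval_X_sub_C_shift (a : ℂ) :
    aeval shift (X - C a) = shift - algebraMap ℂ (SeqHilbert →L[ℂ] SeqHilbert) a := by
  simp

instance : Nontrivial SeqHilbert := ⟨impulse, 0, fun h => by
  have := congrArg (fun u : SeqHilbert => u 0) h
  simp [impulse] at this⟩

theorem isUnit_aeval_shift_X_sub_C {a : ℂ} (ha : 1 < ‖a‖) : IsUnit (aeval shift (X - C a)) := by
  rw [aeval_X_sub_C_shift, IsUnit.sub_iff]
  exact spectrum.mem_resolventSet_of_norm_lt (norm_shift_le.trans_lt ha)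

theorem denseRange_of_adjoint_eq_zero (T : SeqHilbert →L[ℂ] SeqHilbert)
    (h : ∀ u, ContinuousLinearMap.adjoint T u = 0 → u = 0) : DenseRange T := by
  have h1 : (T.range)ᗮ = ⊥ := by
    rw [ContinuousLinearMap.orthogonal_range, eq_bot_iff]
    intro u hu
    exact h u hu
  have h2 := (Submodule.topologicalClosure_eq_top_iff (K := T.range)).2 h1
  have h3 := (Submodule.dense_iff_topologicalClosure_eq_top).2 h2
  rwa [LinearMap.coe_range] at h3

/-- A kernel element of the adjoint `S* - ā` is geometric with ratio `ā`. As `|ā| ≥ 1` it does not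
decay, so square summability forces it to vanish. -/
theorem denseRange_aeval_shift_X_sub_C {a : ℂ} (ha : 1 ≤ ‖a‖) :
    DenseRange (aeval shift (X - C a)) := by
  apply denseRange_of_adjoint_eq_zero
  intro u hu
  have hrec : ∀ t, u (t + 1) = (starRingEnd ℂ) a * u t := by
    intro t
    have h := congrArg (fun u : SeqHilbert => u t) hu
    rw [aeval_X_sub_C_shift, Algebra.algebraMap_eq_smul_one, map_sub] at h
    simp only [map_smulₛₗ, ContinuousLinearMap.adjoint_id, ContinuousLinearMap.one_def] at h
    exact sub_eq_zero.1 (by rw [← adjoint_shift_apply]; exact h)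
  have hmono : ∀ t, ‖u 0‖ ≤ ‖u t‖ := by
    intro t
    induction t with
    | zero => exact le_rfl
    | succ t ih =>
      rw [hrec, norm_mul, RCLike.norm_conj]
      nlinarith [norm_nonneg (u t)]
  have hlim := (hasSum_norm_sq u).summable.tendsto_atTop_zero
  have h0 : ‖u 0‖ ^ 2 ≤ 0 :=
    ge_of_tendsto' hlim (fun t => by gcongr; exact hmono t)
  have h00 : u 0 = 0 := by
    rw [← norm_eq_zero]; nlinarith [norm_nonneg (u 0)]
  ext t
  induction t with
  | zero => simpa using h00
  | succ t ih => rw [hrec, ih]; simp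

/-- Every property of nonzero complex polynomials that holds for constants and passes to products
with linear factors holds for all of them. -/
theorem nonzero_polynomial_induction {P : ℂ[X] → Prop} (hC : ∀ c : ℂ, c ≠ 0 → P (C c))
    (hX : ∀ (a : ℂ) (s : ℂ[X]), s ≠ 0 → P s → P ((X - C a) * s)) :
    ∀ s : ℂ[X], s ≠ 0 → P s := by
  intro s hs
  induction hd : s.natDegree generalizing s with
  | zero =>
    obtain ⟨c, rfl⟩ := natDegree_eq_zero.1 hd
    exact hC c (by rintro rfl; simp at hs)
  | succ d ih =>
    obtain ⟨a, ha⟩ := IsAlgClosed.exists_root s (by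
      intro h; rw [natDegree_eq_of_degree_eq_some h] at hd; simp at hd)
    obtain ⟨r, rfl⟩ := dvd_iff_isRoot.2 ha
    have hr : r ≠ 0 := right_ne_zero_of_mul hs
    refine hX a r hr (ih r hr ?_)
    rw [natDegree_mul (X_sub_C_ne_zero a) hr, natDegree_X_sub_C] at hd
    omega

theorem isUnit_aeval_shift (s : ℂ[X]) (hs : ∀ l : ℂ, ‖l‖ ≤ 1 → s.eval l ≠ 0) :
    IsUnit (aeval shift s) := by
  have hs0 : s ≠ 0 := by rintro rfl; exact hs 0 (by simp) (by simp)
  revert hs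
  refine nonzero_polynomial_induction (P := fun s => (∀ l : ℂ, ‖l‖ ≤ 1 → s.eval l ≠ 0) →
    IsUnit (aeval shift s)) ?_ ?_ s hs0
  · intro c hc _
    rw [aeval_C]
    exact (IsUnit.mk0 c hc).map _
  · intro a s _ ih h
    rw [map_mul]
    refine IsUnit.mul (isUnit_aeval_shift_X_sub_C ?_) (ih fun l hl h0 => h l hl (by simp [h0]))
    by_contra hlt
    exact h a (not_lt.1 hlt) (by simp)

/-- The easy half of Beurling's theorem on outer functions, for polynomials: zeros on the circle
destroy invertibility but not density of the range. -/
theorem denseRange_aeval_shift (s : ℂ[X]) (hs : ∀ l : ℂ, ‖l‖ < 1 → s.eval l ≠ 0) :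
    DenseRange (aeval shift s) := by
  have hs0 : s ≠ 0 := by rintro rfl; exact hs 0 (by simp) (by simp)
  revert hs
  refine nonzero_polynomial_induction (P := fun s => (∀ l : ℂ, ‖l‖ < 1 → s.eval l ≠ 0) →
    DenseRange (aeval shift s)) ?_ ?_ s hs0
  · intro c hc _
    apply Function.Surjective.denseRange
    intro u
    refine ⟨aeval shift (C c⁻¹) u, ?_⟩
    rw [← mul_apply_eq_comp, ← map_mul, ← C_mul, mul_inv_cancel₀ hc, C_1, map_one]
    rfl
  · intro a s _ ih h
    have ha : 1 ≤ ‖a‖ := by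
      by_contra hlt
      exact h a (not_le.1 hlt) (by simp)
    have hs := ih fun l hl h0 => h l hl (by simp [h0])
    have e : (aeval shift ((X - C a) * s) : SeqHilbert → SeqHilbert) =
        (aeval shift (X - C a) : SeqHilbert → SeqHilbert) ∘ aeval shift s := by
      rw [map_mul]
      rfl
    rw [e]
    exact (denseRange_aeval_shift_X_sub_C ha).comp hs (ContinuousLinearMap.continuous _)

/-- A polynomial as a finitely supported sequence. -/
noncomputable def ofPoly (p : ℂ[X]) : SeqHilbert := aeval shift p impulse

theorem ofPoly_eq_sum (p : ℂ[X]) :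
    ofPoly p = ∑ t ∈ Finset.range (p.natDegree + 1), lp.single 2 t (p.coeff t) := by
  have hpow : ∀ t : ℕ, (shift ^ t) impulse = lp.single 2 t 1 := by
    intro t
    induction t with
    | zero => rfl
    | succ t ih => rw [pow_succ', mul_apply_eq_comp, ih, shift_single]
  rw [ofPoly, aeval_eq_sum_range, _root_.sum_apply]
  refine Finset.sum_congr rfl fun t _ => ?_
  rw [_root_.smul_apply, hpow, ← lp.single_smul]
  simp

theorem ofPoly_apply (p : ℂ[X]) (t : ℕ) : ofPoly p t = p.coeff t := by
  rw [ofPoly_eq_sum]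
  rw [seqHilbert_sum_apply]
  simp only [lp.coeFn_single, Pi.single_apply]
  rw [Finset.sum_ite_eq]
  split_ifs with h
  · rfl
  · exact (coeff_eq_zero_of_natDegree_lt (by simpa using h)).symm

theorem aeval_ofPoly (s p : ℂ[X]) : aeval shift s (ofPoly p) = ofPoly (s * p) := by
  simp [ofPoly]

theorem ofPoly_sum {ι : Type*} (s : Finset ι) (f : ι → ℂ[X]) :
    ofPoly (∑ i ∈ s, f i) = ∑ i ∈ s, ofPoly (f i) := by
  simp [ofPoly]

theorem denseRange_ofPoly : DenseRange ofPoly := by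
  intro u
  have h := (lp.hasSum_single (p := 2) (by norm_num) u).tendsto_sum_nat
  refine mem_closure_of_tendsto h (Eventually.of_forall fun N => ?_)
  refine ⟨∑ t ∈ Finset.range N, monomial t (u t), ?_⟩
  rw [ofPoly_sum]
  refine Finset.sum_congr rfl fun t _ => ?_
  ext s
  rw [ofPoly_apply, coeff_monomial, lp.coeFn_single, Pi.single_apply]
  simp [eq_comm]

theorem inner_ofPoly (p q : ℂ[X]) {N : ℕ} (hp : p.natDegree < N) :
    inner ℂ (ofPoly p) (ofPoly q) =
      ∑ t ∈ Finset.range N, (starRingEnd ℂ) (p.coeff t) * q.coeff t := by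
  rw [lp.inner_eq_tsum, tsum_eq_sum (s := Finset.range N)]
  · refine Finset.sum_congr rfl fun t _ => ?_
    rw [ofPoly_apply, ofPoly_apply, RCLike.inner_apply, mul_comm]
  · intro t ht
    rw [ofPoly_apply, coeff_eq_zero_of_natDegree_lt (by simp at ht; omega), inner_zero_left]

/-- Parseval's identity for polynomials, with an average over roots of unity. -/
theorem inner_ofPoly_eq_average (p q : ℂ[X]) {N : ℕ} (hp : p.natDegree < N)
    (hq : q.natDegree < N) {ζ : ℂ} (hζ : IsPrimitiveRoot ζ N) :
    inner ℂ (ofPoly p) (ofPoly q) =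
      (N : ℂ)⁻¹ * ∑ j ∈ Finset.range N, (starRingEnd ℂ) (p.eval (ζ ^ j)) * q.eval (ζ ^ j) := by
  have hN : N ≠ 0 := by omega
  have hζn : ‖ζ‖ = 1 := hζ.norm'_eq_one hN
  have hζ0 : ζ ≠ 0 := hζ.ne_zero hN
  have hconj : (starRingEnd ℂ) ζ = ζ⁻¹ := by
    rw [Complex.inv_def, Complex.normSq_eq_norm_sq, hζn]; simp
  -- Orthogonality of characters. Both exponents are below `N`, so distinct exponents cannot alias.
  have key : ∀ s ∈ Finset.range N, ∀ t ∈ Finset.range N,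
      ∑ j ∈ Finset.range N, (ζ⁻¹ ^ j) ^ s * (ζ ^ j) ^ t = if s = t then (N : ℂ) else 0 := by
    intro s hs t ht
    rw [Finset.mem_range] at hs ht
    have h1 : ∀ j, (ζ⁻¹ ^ j) ^ s * (ζ ^ j) ^ t = (ζ⁻¹ ^ s * ζ ^ t) ^ j := by
      intro j; rw [mul_pow, ← pow_mul, ← pow_mul, ← pow_mul, ← pow_mul, mul_comm j s, mul_comm j t]
    simp_rw [h1]
    split_ifs with hst
    · subst hst
      rw [← mul_pow, inv_mul_cancel₀ hζ0]; simp
    · have hne : ζ⁻¹ ^ s * ζ ^ t ≠ 1 := by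
        intro h
        apply hst
        refine hζ.pow_inj hs ht ?_
        rw [inv_pow] at h
        exact ((inv_mul_eq_one₀ (pow_ne_zero _ hζ0)).1 h)
      have hpow : (ζ⁻¹ ^ s * ζ ^ t) ^ N = 1 := by
        rw [mul_pow, ← pow_mul, ← pow_mul, mul_comm s, mul_comm t, pow_mul, pow_mul, inv_pow,
          hζ.pow_eq_one]; simp
      rw [geom_sum_eq hne, hpow]; simp
  have hexp : ∀ j, (starRingEnd ℂ) (p.eval (ζ ^ j)) * q.eval (ζ ^ j) =
      ∑ s ∈ Finset.range N, ∑ t ∈ Finset.range N,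
        (starRingEnd ℂ) (p.coeff s) * q.coeff t * ((ζ⁻¹ ^ j) ^ s * (ζ ^ j) ^ t) := by
    intro j
    rw [eval_eq_sum_range' hp, eval_eq_sum_range' hq, map_sum, Finset.sum_mul_sum]
    refine Finset.sum_congr rfl fun s _ => Finset.sum_congr rfl fun t _ => ?_
    rw [map_mul, map_pow, map_pow, hconj]; ring
  simp_rw [hexp]
  rw [inner_ofPoly p q hp, Finset.sum_comm]
  have : ∀ s ∈ Finset.range N, ∑ j ∈ Finset.range N, ∑ t ∈ Finset.range N,
      (starRingEnd ℂ) (p.coeff s) * q.coeff t * ((ζ⁻¹ ^ j) ^ s * (ζ ^ j) ^ t) =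
      (starRingEnd ℂ) (p.coeff s) * q.coeff s * N := by
    intro s hs
    rw [Finset.sum_comm]
    rw [Finset.sum_congr rfl fun t ht => by rw [← Finset.mul_sum, key s hs t ht]]
    simp [Finset.mem_range.1 hs]
  rw [Finset.sum_congr rfl this, ← Finset.sum_mul]
  field_simp

/-! ### Frequency-wise lower bounds -/

theorem conj_eq_inv_of_norm_eq_one {l : ℂ} (hl : ‖l‖ = 1) : (starRingEnd ℂ) l = l⁻¹ := by
  rw [Complex.inv_def, Complex.normSq_eq_norm_sq, hl]; simp

/-- On the circle conjugation is inversion; this makes conjugates of polynomials polynomial again,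
up to the unimodular factor `l ^ d`. -/
theorem eval_reflect_map_conj (p : ℂ[X]) {d : ℕ} (hd : p.natDegree ≤ d) {l : ℂ} (hl : ‖l‖ = 1) :
    (reflect d (p.map (starRingEnd ℂ))).eval l = l ^ d * (starRingEnd ℂ) (p.eval l) := by
  have hl0 : l ≠ 0 := by rintro rfl; simp at hl
  let _ : Invertible (l⁻¹) := invertibleOfNonzero (inv_ne_zero hl0)
  have h := eval₂_reflect_mul_pow (RingHom.id ℂ) (l⁻¹) d (p.map (starRingEnd ℂ))
    (natDegree_map_le.trans hd)
  rw [invOf_eq_inv, inv_inv, eval₂_id, eval₂_id] at h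
  have h2 : (p.map (starRingEnd ℂ)).eval (l⁻¹) = (starRingEnd ℂ) (p.eval l) := by
    rw [← conj_eq_inv_of_norm_eq_one hl, eval_map_apply]
  rw [h2, inv_pow] at h
  rw [← h]
  field_simp

/-- A factor `l - a` with `|a| < 1` is at least `1 - |a|` on the circle, so it can be absorbed into
the constant; only the remaining roots are kept in `p`. -/
theorem exists_outer_le (s : ℂ[X]) (hs : s ≠ 0) :
    ∃ c : ℝ, 0 < c ∧ ∃ p : ℂ[X], (∀ l : ℂ, ‖l‖ < 1 → p.eval l ≠ 0) ∧
      ∀ l : ℂ, ‖l‖ = 1 → c * ‖p.eval l‖ ≤ ‖s.eval l‖ := by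
  refine nonzero_polynomial_induction (P := fun s => ∃ c : ℝ, 0 < c ∧ ∃ p : ℂ[X],
    (∀ l : ℂ, ‖l‖ < 1 → p.eval l ≠ 0) ∧ ∀ l : ℂ, ‖l‖ = 1 → c * ‖p.eval l‖ ≤ ‖s.eval l‖)
    ?_ ?_ s hs
  · intro c hc
    exact ⟨‖c‖, norm_pos_iff.2 hc, 1, by simp, by simp⟩
  · rintro a s - ⟨c, hc, p, hp, h⟩
    by_cases ha : ‖a‖ < 1
    · refine ⟨(1 - ‖a‖) * c, mul_pos (sub_pos.2 ha) hc, p, hp, fun l hl => ?_⟩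
      rw [eval_mul, norm_mul, mul_assoc]
      have h1 : 1 - ‖a‖ ≤ ‖(X - C a).eval l‖ := by
        have := norm_sub_norm_le l a
        simpa [hl] using this
      exact mul_le_mul h1 (h l hl) (by positivity) (norm_nonneg _)
    · refine ⟨c, hc, (X - C a) * p, fun l hl h0 => ?_, fun l hl => ?_⟩
      · rw [eval_mul, mul_eq_zero] at h0
        rcases h0 with h0 | h0
        · rw [eval_sub, eval_X, eval_C, sub_eq_zero] at h0
          exact ha (h0 ▸ hl)
        · exact hp l hl h0
      · rw [eval_mul, eval_mul, norm_mul, norm_mul, mul_left_comm]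
        exact mul_le_mul_of_nonneg_left (h l hl) (norm_nonneg _)

variable {κ ι : Type*} [Fintype κ] [Fintype ι]

open scoped MatrixOrder Matrix.Norms.L2Operator in
theorem posSemidef_cauchySchwarz [DecidableEq ι] {P : Matrix ι ι ℂ} (hP : P.PosSemidef)
    (y u : ι → ℂ) :
    ‖star y ⬝ᵥ P *ᵥ u‖ ^ 2 ≤ (star y ⬝ᵥ P *ᵥ y).re * (star u ⬝ᵥ P *ᵥ u).re := by
  obtain ⟨B, rfl⟩ := CStarAlgebra.nonneg_iff_eq_star_mul_self.1 hP.nonneg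
  have key : ∀ a b : ι → ℂ, star a ⬝ᵥ (Bᴴ * B) *ᵥ b =
      inner ℂ (WithLp.toLp 2 (B *ᵥ a)) (WithLp.toLp 2 (B *ᵥ b) : EuclideanSpace ℂ ι) := by
    intro a b
    rw [EuclideanSpace.inner_toLp_toLp, ← mulVec_mulVec, dotProduct_mulVec, star_mulVec, dotProduct_comm]
  rw [star_eq_conjTranspose] at hP ⊢
  simp only [key]
  have hself : ∀ z : EuclideanSpace ℂ ι, (inner ℂ z z).re = ‖z‖ ^ 2 := fun z => by
    rw [inner_self_eq_norm_sq_to_K]; norm_cast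
  rw [hself, hself, ← mul_pow]
  gcongr
  exact norm_inner_le_norm _ _

/-- A quantitative replacement for spectral factorization: the form dominates a multiple of `|det|²`
because the adjugate is bounded on the circle, and the determinant is then replaced by its outer
part. -/
theorem exists_outer_lower_bound [DecidableEq ι] (Y : Matrix κ ι ℂ[X]) (Q : Matrix κ κ ℂ)
    (hpsd : ∀ l : ℂ, ‖l‖ = 1 → ((Y.map (eval l))ᴴ * Q * Y.map (eval l)).PosSemidef)
    {l₀ : ℂ} (hl₀ : ‖l₀‖ = 1) (hpd : ((Y.map (eval l₀))ᴴ * Q * Y.map (eval l₀)).PosDef) :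
    ∃ c : ℝ, 0 < c ∧ ∃ p : ℂ[X], (∀ l : ℂ, ‖l‖ < 1 → p.eval l ≠ 0) ∧
      ∀ l : ℂ, ‖l‖ = 1 → ∀ u : ι → ℂ, c * (‖p.eval l‖ ^ 2 * ∑ i, ‖u i‖ ^ 2) ≤
        (star u ⬝ᵥ ((Y.map (eval l))ᴴ * Q * Y.map (eval l)) *ᵥ u).re := by
  set P : ℂ → Matrix ι ι ℂ := fun l => (Y.map (eval l))ᴴ * Q * Y.map (eval l) with hPdef
  obtain ⟨d, hd⟩ : ∃ d, ∀ a b, (Y a b).natDegree ≤ d :=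
    ⟨∑ a, ∑ b, (Y a b).natDegree, fun a b =>
      (Finset.single_le_sum (f := fun b => (Y a b).natDegree) (fun _ _ => Nat.zero_le _)
        (Finset.mem_univ b)).trans
      (Finset.single_le_sum (f := fun a => ∑ b, (Y a b).natDegree) (fun _ _ => Nat.zero_le _)
        (Finset.mem_univ a))⟩
  -- `R` is a polynomial matrix that equals `l ^ d • P l` on the circle; definiteness at `l₀` makes
  -- its determinant a nonzero polynomial.
  let Yr : Matrix ι κ ℂ[X] := fun b a => reflect d ((Y a b).map (starRingEnd ℂ))
  let R : Matrix ι ι ℂ[X] := Yr * Q.map C * Y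
  have hR : ∀ l : ℂ, ‖l‖ = 1 → R.map (eval l) = l ^ d • P l := by
    intro l hl
    have h1 : Yr.map (eval l) = l ^ d • (Y.map (eval l))ᴴ := by
      ext b a
      exact eval_reflect_map_conj _ (hd a b) hl
    have h2 : (Q.map C).map (eval l) = Q := by ext; simp
    change (Yr * Q.map C * Y).map (evalRingHom l) = _
    rw [Matrix.map_mul, Matrix.map_mul]
    change Yr.map (eval l) * (Q.map C).map (eval l) * Y.map (eval l) = _
    rw [h1, h2, hPdef, smul_mul, smul_mul]
  have hdet : ∀ l : ℂ, R.det.eval l = (R.map (eval l)).det := fun l =>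
    (evalRingHom l).map_det R
  have hs : R.det ≠ 0 := by
    intro h
    have h1 := hdet l₀
    rw [h, eval_zero, hR l₀ hl₀, det_smul] at h1
    have h2 : l₀ ^ d ≠ 0 := pow_ne_zero _ (by rintro rfl; simp at hl₀)
    exact mul_ne_zero (pow_ne_zero _ h2) hpd.det_pos.ne' h1.symm
  -- Conjugated rows of the adjugate: `adj R * R = det R` writes `det R * u i` as a pairing in the
  -- form `P l`, to which Cauchy-Schwarz applies.
  let y : ℂ → ι → ι → ℂ := fun l i j => (starRingEnd ℂ) ((R.adjugate i j).eval l)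
  have hadj : ∀ l : ℂ, ‖l‖ = 1 → ∀ u : ι → ℂ, ∀ i,
      ‖R.det.eval l‖ ^ 2 * ‖u i‖ ^ 2 = ‖star (y l i) ⬝ᵥ P l *ᵥ u‖ ^ 2 := by
    intro l hl u i
    have h1 : (R.adjugate.map (eval l)) * (R.map (eval l)) = R.det.eval l • 1 := by
      have h := congrArg (fun M : Matrix ι ι ℂ[X] => M.map (evalRingHom l)) (adjugate_mul R)
      simp only [Matrix.map_mul] at h
      refine h.trans ?_
      ext a b
      by_cases hab : a = b <;> simp [one_apply, hab]
    have h2 : R.det.eval l * u i = l ^ d * (star (y l i) ⬝ᵥ P l *ᵥ u) := by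
      have h := congrArg (fun M : Matrix ι ι ℂ => (M *ᵥ u) i) h1
      simp only [smul_mulVec, one_mulVec, Pi.smul_apply, smul_eq_mul] at h
      rw [← h, hR l hl, Matrix.mul_smul, smul_mulVec, ← mulVec_mulVec, Pi.smul_apply, smul_eq_mul]
      congr 1
      refine Finset.sum_congr rfl fun j _ => ?_
      simp [y]
    rw [← mul_pow, ← norm_mul, h2, norm_mul, norm_pow, hl, one_pow, one_mul]
  have hcont : Continuous fun l => ∑ i, (star (y l i) ⬝ᵥ P l *ᵥ y l i).re := by
    simp only [hPdef, y, dotProduct, mulVec, Matrix.mul_apply, map_apply, conjTranspose_apply,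
      Pi.star_apply, RCLike.star_def]
    fun_prop
  obtain ⟨K, hK⟩ := (isCompact_sphere (0 : ℂ) 1).exists_bound_of_continuousOn hcont.continuousOn
  have hK0 : 0 < |K| + 1 := by positivity
  obtain ⟨c, hc, p, hp, hle⟩ := exists_outer_le R.det hs
  refine ⟨c ^ 2 / (|K| + 1), by positivity, p, hp, fun l hl u => ?_⟩
  have hu : 0 ≤ (star u ⬝ᵥ P l *ᵥ u).re := (Complex.nonneg_iff.1
    ((hpsd l hl).dotProduct_mulVec_nonneg u)).1
  have h1 : ‖R.det.eval l‖ ^ 2 * ∑ i, ‖u i‖ ^ 2 ≤ (|K| + 1) * (star u ⬝ᵥ P l *ᵥ u).re := by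
    rw [Finset.mul_sum, Finset.sum_congr rfl fun i _ => hadj l hl u i]
    refine (Finset.sum_le_sum fun i _ => posSemidef_cauchySchwarz (hpsd l hl) (y l i) u).trans ?_
    rw [← Finset.sum_mul]
    gcongr
    have := (le_abs_self _).trans (hK l (by simpa using hl))
    linarith [le_abs_self K]
  have h2 : (c * ‖p.eval l‖) ^ 2 ≤ ‖R.det.eval l‖ ^ 2 := by
    gcongr
    exact hle l hl
  rw [div_mul_eq_mul_div, div_le_iff₀ hK0, mul_comm _ (|K| + 1)]
  refine le_trans ?_ h1
  rw [← mul_assoc, ← mul_pow]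
  gcongr

/-! ### Polynomial matrices acting on vectors of sequences -/

section PolynomialAction

variable {κ ι μ : Type*} [Fintype κ] [Fintype ι] [Fintype μ]

/-- The action of a polynomial matrix in the shift on vectors of square summable sequences. -/
noncomputable def polyAct (M : Matrix κ ι ℂ[X]) : (ι → SeqHilbert) →L[ℂ] (κ → SeqHilbert) :=
  ContinuousLinearMap.pi fun i =>
    ∑ j, (aeval shift (M i j)).comp (ContinuousLinearMap.proj (R := ℂ) (φ := fun _ => SeqHilbert) j)

theorem polyAct_apply (M : Matrix κ ι ℂ[X]) (u : ι → SeqHilbert) (i : κ) :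
    polyAct M u i = ∑ j, aeval shift (M i j) (u j) := by
  simp [polyAct]

theorem polyAct_mul (M : Matrix κ ι ℂ[X]) (N : Matrix ι μ ℂ[X]) (u : μ → SeqHilbert) :
    polyAct (M * N) u = polyAct M (polyAct N u) := by
  ext1 i
  simp only [polyAct_apply, Matrix.mul_apply, map_sum, map_mul, _root_.sum_apply,
    mul_apply_eq_comp]
  rw [Finset.sum_comm]

theorem polyAct_smul_one [DecidableEq ι] (p : ℂ[X]) (u : ι → SeqHilbert) (i : ι) :
    polyAct (p • (1 : Matrix ι ι ℂ[X])) u i = aeval shift p (u i) := by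
  rw [polyAct_apply, Finset.sum_eq_single i]
  · simp
  · intro j _ hj
    simp [one_apply_ne hj.symm]
  · simp

theorem polyAct_comm (M : Matrix κ ι ℂ[X]) {T : SeqHilbert →L[ℂ] SeqHilbert}
    (hT : ∀ (p : ℂ[X]) (u : SeqHilbert), aeval shift p (T u) = T (aeval shift p u))
    (u : ι → SeqHilbert) (i : κ) : polyAct M (fun j => T (u j)) i = T (polyAct M u i) := by
  simp only [polyAct_apply, hT, map_sum]

theorem aeval_shift_comm (p q : ℂ[X]) (u : SeqHilbert) :
    aeval shift p (aeval shift q u) = aeval shift q (aeval shift p u) := by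
  rw [← mul_apply_eq_comp, ← mul_apply_eq_comp, ← map_mul, ← map_mul, mul_comm]

theorem polyAct_ofPoly (M : Matrix κ ι ℂ[X]) (f : ι → ℂ[X]) (i : κ) :
    polyAct M (fun j => ofPoly (f j)) i = ofPoly ((M *ᵥ f) i) := by
  simp only [polyAct_apply, aeval_ofPoly, mulVec, dotProduct, ofPoly_sum]

theorem denseRange_ofPoly_pi : DenseRange fun (f : ι → ℂ[X]) (i : ι) => ofPoly (f i) :=
  DenseRange.piMap fun _ => denseRange_ofPoly

/-- The sesquilinear form `∑ t, y(t)' R y'(t)`. -/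
noncomputable def sesq (R : Matrix κ κ ℂ) (y : κ → SeqHilbert) : (κ → SeqHilbert) →L[ℂ] ℂ :=
  ∑ i, ∑ j, R i j • (innerSL ℂ (y i)).comp
    (ContinuousLinearMap.proj (R := ℂ) (φ := fun _ => SeqHilbert) j)

theorem sesq_apply (R : Matrix κ κ ℂ) (y y' : κ → SeqHilbert) :
    sesq R y y' = ∑ i, ∑ j, R i j * inner ℂ (y i) (y' j) := by
  simp [sesq]

theorem sesq_conj (R : Matrix κ κ ℂ) (y y' : κ → SeqHilbert) :
    (starRingEnd ℂ) (sesq R y y') = sesq Rᴴ y' y := by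
  simp only [sesq_apply, map_sum, map_mul, inner_conj_symm, conjTranspose_apply, RCLike.star_def]
  rw [Finset.sum_comm]

/-- A quadratic form that is nonnegative frequency by frequency is nonnegative. -/
theorem re_sesq_polyAct_nonneg (G : Matrix κ ι ℂ[X]) (R : Matrix κ κ ℂ)
    (h : ∀ l : ℂ, ‖l‖ = 1 → ∀ u : ι → ℂ,
      0 ≤ (star u ⬝ᵥ ((G.map (eval l))ᴴ * R * G.map (eval l)) *ᵥ u).re)
    (u : ι → SeqHilbert) : 0 ≤ (sesq R (polyAct G u) (polyAct G u)).re := by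
  refine denseRange_ofPoly_pi.induction_on (p := fun u =>
    0 ≤ (sesq R (polyAct G u) (polyAct G u)).re) u ?_ fun f => ?_
  · refine isClosed_le continuous_const ?_
    simp only [sesq_apply]
    fun_prop
  -- With more roots of unity than the degrees occurring, the discrete average computes the form
  -- exactly, as a mean of nonnegative terms.
  obtain ⟨N, hN⟩ : ∃ N, ∀ i, ((G *ᵥ f) i).natDegree < N :=
    ⟨∑ i, ((G *ᵥ f) i).natDegree + 1, fun i => Nat.lt_succ_of_le
      (Finset.single_le_sum (f := fun i => ((G *ᵥ f) i).natDegree) (fun _ _ => Nat.zero_le _)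
        (Finset.mem_univ i))⟩
  rcases isEmpty_or_nonempty κ with hκ | ⟨⟨i₀⟩⟩
  · simp [sesq_apply]
  have hN0 : N ≠ 0 := by have := hN i₀; omega
  have hζ := Complex.isPrimitiveRoot_exp N hN0
  set ζ := Complex.exp (2 * Real.pi * Complex.I / N)
  have heval : ∀ l : ℂ, ∀ i, ((G *ᵥ f) i).eval l =
      (G.map (eval l) *ᵥ fun j => (f j).eval l) i := by
    intro l i
    simp [mulVec, dotProduct, eval_finsetSum]
  have key : sesq R (polyAct G fun i => ofPoly (f i)) (polyAct G fun i => ofPoly (f i)) =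
      (N : ℂ)⁻¹ * ∑ j ∈ Finset.range N, star (fun i => (f i).eval (ζ ^ j)) ⬝ᵥ
        ((G.map (eval (ζ ^ j)))ᴴ * R * G.map (eval (ζ ^ j))) *ᵥ fun i => (f i).eval (ζ ^ j) := by
    simp only [sesq_apply, polyAct_ofPoly,
      fun i i' => inner_ofPoly_eq_average _ _ (hN i) (hN i') hζ]
    have hrhs : ∀ j : ℕ, star (fun i => (f i).eval (ζ ^ j)) ⬝ᵥ
        ((G.map (eval (ζ ^ j)))ᴴ * R * G.map (eval (ζ ^ j))) *ᵥ (fun i => (f i).eval (ζ ^ j)) =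
        ∑ a, ∑ b, R a b * ((starRingEnd ℂ) (((G *ᵥ f) a).eval (ζ ^ j)) *
          ((G *ᵥ f) b).eval (ζ ^ j)) := by
      intro j
      rw [← mulVec_mulVec, ← mulVec_mulVec, dotProduct_mulVec, ← star_mulVec]
      simp only [heval]
      rw [dotProduct]
      refine Finset.sum_congr rfl fun a _ => ?_
      rw [mulVec, dotProduct, Finset.mul_sum]
      refine Finset.sum_congr rfl fun b _ => ?_
      simp only [Pi.star_apply, RCLike.star_def]
      ring
    simp_rw [hrhs]
    simp only [Finset.mul_sum]
    conv_rhs => rw [Finset.sum_comm]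
    refine Finset.sum_congr rfl fun a _ => ?_
    conv_rhs => rw [Finset.sum_comm]
    exact Finset.sum_congr rfl fun b _ => Finset.sum_congr rfl fun j _ => by ring
  rw [key, ← Complex.ofReal_natCast, ← Complex.ofReal_inv, Complex.re_ofReal_mul, Complex.re_sum]
  refine mul_nonneg (by positivity) (Finset.sum_nonneg fun j _ => h _ ?_ _)
  rw [norm_pow, hζ.norm'_eq_one hN0, one_pow]

/-- The time domain form of a frequency-wise lower bound. -/
theorem le_re_sesq_of_lower_bound [DecidableEq ι] (Y : Matrix κ ι ℂ[X]) (Q : Matrix κ κ ℂ) (c : ℝ)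
    (p : ℂ[X])
    (h : ∀ l : ℂ, ‖l‖ = 1 → ∀ u : ι → ℂ, c * (‖p.eval l‖ ^ 2 * ∑ i, ‖u i‖ ^ 2) ≤
      (star u ⬝ᵥ ((Y.map (eval l))ᴴ * Q * Y.map (eval l)) *ᵥ u).re) (u : ι → SeqHilbert) :
    c * ∑ i, ‖aeval shift p (u i)‖ ^ 2 ≤ (sesq Q (polyAct Y u) (polyAct Y u)).re := by
  -- Stacking `p` below `Y` with weight `-c` turns the lower bound into a nonnegativity statement.
  have h1 := re_sesq_polyAct_nonneg (fromRows Y (p • (1 : Matrix ι ι ℂ[X])))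
    (fromBlocks Q 0 0 (-(c : ℂ) • (1 : Matrix ι ι ℂ))) (fun l hl u => by
      have e1 : (fromRows Y (p • (1 : Matrix ι ι ℂ[X]))).map (eval l) =
          fromRows (Y.map (eval l)) (p.eval l • 1) := by
        ext (i | i) j
        · rfl
        · by_cases hij : i = j <;> simp [one_apply, hij]
      rw [e1, conjTranspose_fromRows_eq_fromCols_conjTranspose, fromCols_mul_fromBlocks,
        fromCols_mul_fromRows]
      simp only [Matrix.mul_zero, add_zero, zero_add, conjTranspose_smul, conjTranspose_one,
        Matrix.smul_mul, Matrix.mul_smul, Matrix.one_mul, add_mulVec, dotProduct_add, smul_mulVec,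
        one_mulVec, dotProduct_smul, smul_eq_mul, Complex.add_re]
      have e2 : star u ⬝ᵥ u = ((∑ i, ‖u i‖ ^ 2 : ℝ) : ℂ) := by
        simp [dotProduct, Complex.conj_mul']
      have e3 : eval l p * (-(c : ℂ) * (star (eval l p) * star u ⬝ᵥ u)) =
          ((-(c * (‖p.eval l‖ ^ 2 * ∑ i, ‖u i‖ ^ 2)) : ℝ) : ℂ) := by
        rw [e2, mul_left_comm, ← mul_assoc (eval l p), RCLike.star_def, Complex.mul_conj']
        push_cast; ring
      rw [e3, Complex.ofReal_re]
      linarith [h l hl u]) u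
  have e : sesq (fromBlocks Q 0 0 (-(c : ℂ) • (1 : Matrix ι ι ℂ)))
      (polyAct (fromRows Y (p • (1 : Matrix ι ι ℂ[X]))) u)
      (polyAct (fromRows Y (p • (1 : Matrix ι ι ℂ[X]))) u) =
      sesq Q (polyAct Y u) (polyAct Y u)
        + ((-(c * ∑ i, ‖aeval shift p (u i)‖ ^ 2) : ℝ) : ℂ) := by
    have hl : ∀ i, polyAct (fromRows Y (p • (1 : Matrix ι ι ℂ[X]))) u (Sum.inl i) =
        polyAct Y u i := fun i => by simp [polyAct_apply]
    have hr : ∀ i, polyAct (fromRows Y (p • (1 : Matrix ι ι ℂ[X]))) u (Sum.inr i) =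
        aeval shift p (u i) := fun i => by
      rw [← polyAct_smul_one, polyAct_apply, polyAct_apply]; rfl
    simp only [sesq_apply, Fintype.sum_sum_type, hl, hr, fromBlocks_apply₁₁, fromBlocks_apply₁₂,
      fromBlocks_apply₂₁, fromBlocks_apply₂₂, Matrix.zero_apply, zero_mul, Finset.sum_const_zero,
      add_zero, zero_add]
    congr 1
    push_cast
    rw [Finset.mul_sum, ← Finset.sum_neg_distrib]
    refine Finset.sum_congr rfl fun i _ => ?_
    rw [Finset.sum_eq_single i]
    · simp [inner_self_eq_norm_sq_to_K]
    · intro j _ hj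
      simp [one_apply_ne hj.symm]
    · simp
  rw [e, Complex.add_re, Complex.ofReal_re] at h1
  linarith

/-- The time domain form of positivity of a frequency-wise block form. -/
theorem re_sesq_blocks_nonneg {ι' : Type*} [Fintype ι'] (Y₁ : Matrix κ ι ℂ[X])
    (Y₂ : Matrix κ ι' ℂ[X]) (Q : Matrix κ κ ℂ) (ε : ℝ)
    (h : ∀ l : ℂ, ‖l‖ = 1 → (fromBlocks ((Y₁.map (eval l))ᴴ * Q * Y₁.map (eval l))
      ((ε : ℂ) • ((Y₁.map (eval l))ᴴ * Q * Y₂.map (eval l)))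
      ((ε : ℂ) • ((Y₂.map (eval l))ᴴ * Q * Y₁.map (eval l)))
      (-((Y₂.map (eval l))ᴴ * Q * Y₂.map (eval l)))).PosSemidef)
    (v : ι → SeqHilbert) (w : ι' → SeqHilbert) :
    0 ≤ (sesq Q (polyAct Y₁ v) (polyAct Y₁ v)).re - (sesq Q (polyAct Y₂ w) (polyAct Y₂ w)).re
      + ε * ((sesq Q (polyAct Y₁ v) (polyAct Y₂ w)).re
        + (sesq Q (polyAct Y₂ w) (polyAct Y₁ v)).re) := by
  have h1 := re_sesq_polyAct_nonneg (fromBlocks Y₁ 0 0 Y₂)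
    (fromBlocks Q ((ε : ℂ) • Q) ((ε : ℂ) • Q) (-Q)) (fun l hl u => by
      have e1 : (fromBlocks Y₁ 0 0 Y₂).map (eval l) =
          fromBlocks (Y₁.map (eval l)) 0 0 (Y₂.map (eval l)) := by
        ext (i | i) (j | j) <;> simp
      rw [e1, fromBlocks_conjTranspose, fromBlocks_multiply, fromBlocks_multiply]
      have h2 := (Complex.nonneg_iff.1 ((h l hl).dotProduct_mulVec_nonneg u)).1
      simpa using h2) (Sum.elim v w)
  have hl : ∀ i, polyAct (fromBlocks Y₁ 0 0 Y₂) (Sum.elim v w) (Sum.inl i) =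
      polyAct Y₁ v i := fun i => by simp [polyAct_apply]
  have hr : ∀ i, polyAct (fromBlocks Y₁ 0 0 Y₂) (Sum.elim v w) (Sum.inr i) =
      polyAct Y₂ w i := fun i => by simp [polyAct_apply]
  have e : sesq (fromBlocks Q ((ε : ℂ) • Q) ((ε : ℂ) • Q) (-Q))
      (polyAct (fromBlocks Y₁ 0 0 Y₂) (Sum.elim v w))
      (polyAct (fromBlocks Y₁ 0 0 Y₂) (Sum.elim v w)) =
      sesq Q (polyAct Y₁ v) (polyAct Y₁ v) - sesq Q (polyAct Y₂ w) (polyAct Y₂ w)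
        + ε * (sesq Q (polyAct Y₁ v) (polyAct Y₂ w) + sesq Q (polyAct Y₂ w) (polyAct Y₁ v)) := by
    simp only [sesq_apply, Fintype.sum_sum_type, hl, hr, fromBlocks_apply₁₁, fromBlocks_apply₁₂,
      fromBlocks_apply₂₁, fromBlocks_apply₂₂, Matrix.smul_apply, Matrix.neg_apply, smul_eq_mul,
      Finset.sum_add_distrib, neg_mul, Finset.sum_neg_distrib, mul_assoc, ← Finset.mul_sum]
    ring
  rw [e] at h1
  simpa using h1

end PolynomialAction

/-! ### Approximate saddle points of convex-concave quadratic functions -/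

/-- In a seminormed space, a coercive bilinear equation is solvable up to arbitrarily small
residuals. -/
theorem exists_approx_solution_of_coercive {E : Type*} [SeminormedAddCommGroup E]
    [InnerProductSpace ℝ E] (B : E →ₗ[ℝ] E →ₗ[ℝ] ℝ) (K : ℝ)
    (hB : ∀ x y, |B x y| ≤ K * ‖x‖ * ‖y‖) (hcoer : ∀ x, ‖x‖ ^ 2 ≤ B x x)
    (l : E →ₗ[ℝ] ℝ) (hl : ∀ y, |l y| ≤ K * ‖y‖) {δ : ℝ} (hδ : 0 < δ) :
    ∃ x, ∀ y, |B x y - l y| ≤ δ * ‖y‖ := by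
  let F := UniformSpace.Completion E
  have repr : ∀ (f : E →ₗ[ℝ] ℝ) (c : ℝ), (∀ y, |f y| ≤ c * ‖y‖) →
      ∃ z : F, ∀ y : E, f y = inner ℝ z (y : F) := by
    intro f c hf
    let f' : E →L[ℝ] ℝ := f.mkContinuous c hf
    let g : F →L[ℝ] ℝ := f'.extend (UniformSpace.Completion.toComplL (𝕜 := ℝ) (E := E))
    refine ⟨(InnerProductSpace.toDual ℝ F).symm g, fun y => ?_⟩
    rw [InnerProductSpace.toDual_symm_apply]
    exact (ContinuousLinearMap.extend_eq f' (UniformSpace.Completion.denseRange_coe)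
      (UniformSpace.Completion.isUniformInducing_coe E) y).symm
  -- The Riesz representatives of the functionals `B x`. Once this subspace is dense in the
  -- completion, the representative of `l` can be approximated.
  let R : Submodule ℝ F :=
    { carrier := {z | ∃ x, ∀ y : E, B x y = inner ℝ z (y : F)}
      add_mem' := by
        rintro a b ⟨x, hx⟩ ⟨x', hx'⟩
        exact ⟨x + x', fun y => by rw [map_add, LinearMap.add_apply, hx, hx', inner_add_left]⟩
      zero_mem' := ⟨0, fun y => by rw [map_zero, LinearMap.zero_apply, inner_zero_left]⟩
      smul_mem' := by
        rintro c a ⟨x, hx⟩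
        exact ⟨c • x, fun y => by
          rw [map_smul, LinearMap.smul_apply, hx, real_inner_smul_left, smul_eq_mul]⟩ }
  have hR : Rᗮ = ⊥ := by
    rw [eq_bot_iff]
    intro z hz
    obtain ⟨u, hu⟩ := mem_closure_iff_seq_limit.1
      (UniformSpace.Completion.denseRange_coe (α := E) z)
    choose x hx using hu.1
    have hlim : Tendsto (fun i => (x i : F)) atTop (𝓝 z) := by
      simpa only [hx] using hu.2
    have hnorm : Tendsto (fun i => ‖x i‖) atTop (𝓝 ‖z‖) := by
      simpa using hlim.norm
    have hdiff : Tendsto (fun i => ‖(x i : F) - z‖) atTop (𝓝 0) := by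
      simpa using (hlim.sub_const z).norm
    -- Coercivity at `x i`, with `z` subtracted for free since it is orthogonal to `R`. In the limit
    -- `‖z‖² ≤ 0`.
    have hle : ∀ i, ‖x i‖ ^ 2 ≤ |K| * ‖x i‖ * ‖(x i : F) - z‖ := by
      intro i
      obtain ⟨a, ha⟩ := repr (B (x i)) (K * ‖x i‖) (hB (x i))
      have haR : a ∈ R := ⟨x i, ha⟩
      have h0 : inner ℝ a z = 0 := hz a haR
      have hna : ‖a‖ ≤ |K| * ‖x i‖ := by
        have hall : ∀ b : F, inner ℝ a b ≤ |K| * ‖x i‖ * ‖b‖ := by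
          intro b
          induction b using UniformSpace.Completion.induction_on with
          | hp => exact isClosed_le (by fun_prop) (by fun_prop)
          | ih y =>
            rw [← ha, UniformSpace.Completion.norm_coe]
            refine (le_abs_self _).trans ((hB _ _).trans ?_)
            gcongr
            exact le_abs_self K
        have h := hall a
        rw [real_inner_self_eq_norm_sq] at h
        rcases (norm_nonneg a).eq_or_lt with h' | h'
        · rw [← h']; positivity
        · nlinarith
      calc ‖x i‖ ^ 2 ≤ B (x i) (x i) := hcoer _
        _ = inner ℝ a ((x i : F) - z) := by rw [inner_sub_right, h0, sub_zero, ha]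
        _ ≤ ‖a‖ * ‖(x i : F) - z‖ := real_inner_le_norm _ _
        _ ≤ _ := by gcongr
    have := le_of_tendsto_of_tendsto' (hnorm.pow 2) ((hnorm.const_mul |K|).mul hdiff) hle
    rw [mul_zero] at this
    rw [Submodule.mem_bot, ← norm_eq_zero]
    nlinarith [norm_nonneg z]
  have hdense := Submodule.dense_iff_topologicalClosure_eq_top.2
    ((Submodule.topologicalClosure_eq_top_iff (K := R)).2 hR)
  obtain ⟨z, hz⟩ := repr l K hl
  obtain ⟨a, ⟨x, hx⟩, ha⟩ := Metric.mem_closure_iff.1 (hdense z) δ hδ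
  refine ⟨x, fun y => ?_⟩
  rw [hx, hz, ← inner_sub_left, ← UniformSpace.Completion.norm_coe y]
  refine (abs_real_inner_le_norm _ _).trans ?_
  rw [dist_comm, dist_eq_norm] at ha
  gcongr

/-- A minimax theorem for quadratic functions that are convex in `v` and concave in `w`: if
`inf_v` is nonpositive for every `w`, then `inf_v sup_w` is nonpositive, and the almost minimizing
`v` may be perturbed. -/
theorem exists_forall_quadratic_le {V W Z : Type*} [AddCommGroup V] [Module ℝ V]
    [AddCommGroup W] [Module ℝ W] [AddCommGroup Z] [Module ℝ Z]
    (Θ : Z →ₗ[ℝ] Z →ₗ[ℝ] ℝ) (hsymm : ∀ x y, Θ x y = Θ y x)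
    (L₁ : V →ₗ[ℝ] Z) (L₂ : W →ₗ[ℝ] Z) (y₀ : Z) (K : ℝ) (hK : 0 ≤ K)
    (ha : ∀ v, 0 ≤ Θ (L₁ v) (L₁ v)) (hb : ∀ w, 0 ≤ -Θ (L₂ w) (L₂ w))
    (hr : ∀ v w, Θ (L₁ v) (L₂ w) ^ 2 ≤ K ^ 2 * (Θ (L₁ v) (L₁ v) * -Θ (L₂ w) (L₂ w)))
    (hl₁ : ∀ v, Θ y₀ (L₁ v) ^ 2 ≤ K ^ 2 * Θ (L₁ v) (L₁ v))
    (hl₂ : ∀ w, Θ y₀ (L₂ w) ^ 2 ≤ K ^ 2 * -Θ (L₂ w) (L₂ w))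
    (hinf : ∀ w, ∀ δ : ℝ, 0 < δ → ∃ v, Θ (y₀ + L₁ v + L₂ w) (y₀ + L₁ v + L₂ w) ≤ δ)
    {δ : ℝ} (hδ : 0 < δ) :
    ∃ v₀, ∃ η : ℝ, 0 < η ∧ ∀ v, Θ (L₁ (v - v₀)) (L₁ (v - v₀)) ≤ η →
      ∀ w, Θ (y₀ + L₁ v + L₂ w) (y₀ + L₁ v + L₂ w) ≤ δ := by
  let ip : PreInnerProductSpace.Core ℝ (V × W) :=
    { inner := fun x y => Θ (L₁ x.1) (L₁ y.1) - Θ (L₂ x.2) (L₂ y.2)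
      conj_inner_symm := fun x y => by simp [hsymm (L₁ y.1), hsymm (L₂ y.2)]
      re_inner_nonneg := fun x => by
        have h1 := ha x.1
        have h2 := hb x.2
        simp only [RCLike.re_to_real]; linarith
      add_left := fun x y z => by simp; ring
      smul_left := fun x y r => by simp; ring }
  let _ : SeminormedAddCommGroup (V × W) :=
    @InnerProductSpace.Core.toSeminormedAddCommGroup ℝ (V × W) _ _ _ ip
  let _ : InnerProductSpace ℝ (V × W) := InnerProductSpace.ofCore ip
  have hinner : ∀ x y : V × W, inner ℝ x y = Θ (L₁ x.1) (L₁ y.1) - Θ (L₂ x.2) (L₂ y.2) :=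
    fun _ _ => rfl
  have hnorm : ∀ x : V × W, ‖x‖ ^ 2 = Θ (L₁ x.1) (L₁ x.1) - Θ (L₂ x.2) (L₂ x.2) := by
    intro x
    rw [← real_inner_self_eq_norm_sq, hinner]
  have h1n : ∀ x : V × W, √(Θ (L₁ x.1) (L₁ x.1)) ≤ ‖x‖ := fun x =>
    Real.sqrt_le_iff.2 ⟨norm_nonneg _, by rw [hnorm]; linarith [hb x.2]⟩
  have h2n : ∀ x : V × W, √(-Θ (L₂ x.2) (L₂ x.2)) ≤ ‖x‖ := fun x =>
    Real.sqrt_le_iff.2 ⟨norm_nonneg _, by rw [hnorm]; linarith [ha x.1]⟩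
  have hr' : ∀ v w, |Θ (L₁ v) (L₂ w)| ≤ K * √(Θ (L₁ v) (L₁ v)) * √(-Θ (L₂ w) (L₂ w)) := by
    intro v w
    refine abs_le_of_sq_le_sq ?_ (by positivity)
    rw [mul_pow, mul_pow, Real.sq_sqrt (ha v), Real.sq_sqrt (hb w), mul_assoc]
    exact hr v w
  have hl₁' : ∀ v, |Θ y₀ (L₁ v)| ≤ K * √(Θ (L₁ v) (L₁ v)) := by
    intro v
    refine abs_le_of_sq_le_sq ?_ (by positivity)
    rw [mul_pow, Real.sq_sqrt (ha v)]
    exact hl₁ v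
  have hl₂' : ∀ w, |Θ y₀ (L₂ w)| ≤ K * √(-Θ (L₂ w) (L₂ w)) := by
    intro w
    refine abs_le_of_sq_le_sq ?_ (by positivity)
    rw [mul_pow, Real.sq_sqrt (hb w)]
    exact hl₂ w
  let p : V × W →ₗ[ℝ] Z := L₁ ∘ₗ LinearMap.fst ℝ V W + L₂ ∘ₗ LinearMap.snd ℝ V W
  let m : V × W →ₗ[ℝ] Z := L₁ ∘ₗ LinearMap.fst ℝ V W - L₂ ∘ₗ LinearMap.snd ℝ V W
  have hp : ∀ x, p x = L₁ x.1 + L₂ x.2 := fun _ => rfl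
  have hm : ∀ x, m x = L₁ x.1 - L₂ x.2 := fun _ => rfl
  -- The final estimate is `ρ + 8ρ²`, which is at most `9ρ` because `ρ ≤ 1`.
  obtain ⟨ρ, hρ, hρ1, hρδ⟩ : ∃ ρ : ℝ, 0 < ρ ∧ ρ ≤ 1 ∧ 9 * ρ ≤ δ :=
    ⟨min 1 (δ / 9), by positivity, min_le_left _ _, by linarith [min_le_right 1 (δ / 9)]⟩
  -- The saddle point equation says that `Θ(y₀ + L₁ v₀ + L₂ w₀, ·)` vanishes on both ranges. Testing
  -- against `L₁ h - L₂ g` flips the concave part, so the cross terms cancel on the diagonal and the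
  -- form is coercive with constant one.
  obtain ⟨⟨v₀, w₀⟩, hx⟩ := exists_approx_solution_of_coercive (Θ.compl₁₂ p m) (1 + 2 * K)
    (fun x y => by
      have h1 := abs_real_inner_le_norm x y
      have h2 := hr' x.1 y.2
      have h3 := hr' y.1 x.2
      have e : (Θ.compl₁₂ p m) x y =
          inner ℝ x y - Θ (L₁ x.1) (L₂ y.2) + Θ (L₁ y.1) (L₂ x.2) := by
        rw [LinearMap.compl₁₂_apply, hp, hm, hinner, hsymm (L₁ y.1)]
        simp only [map_add, map_sub, LinearMap.add_apply]; ring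
      have h2' : K * √(Θ (L₁ x.1) (L₁ x.1)) * √(-Θ (L₂ y.2) (L₂ y.2)) ≤ K * ‖x‖ * ‖y‖ := by
        gcongr
        · exact h1n x
        · exact h2n y
      have h3' : K * √(Θ (L₁ y.1) (L₁ y.1)) * √(-Θ (L₂ x.2) (L₂ x.2)) ≤ K * ‖y‖ * ‖x‖ := by
        gcongr
        · exact h1n y
        · exact h2n x
      rw [e]
      rw [abs_le] at h1 h2 h3 ⊢
      constructor <;> nlinarith)
    (fun x => by
      rw [LinearMap.compl₁₂_apply, hp, hm, hnorm]
      simp only [map_add, map_sub, LinearMap.add_apply]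
      linarith [hsymm (L₁ x.1) (L₂ x.2)])
    (-(Θ y₀ ∘ₗ m))
    (fun y => by
      have h1 := hl₁' y.1
      have h2 := hl₂' y.2
      have h1' := mul_le_mul_of_nonneg_left (h1n y) hK
      have h2' := mul_le_mul_of_nonneg_left (h2n y) hK
      have h0 := norm_nonneg y
      have e : (-(Θ y₀ ∘ₗ m)) y = -Θ y₀ (L₁ y.1) + Θ y₀ (L₂ y.2) := by
        rw [LinearMap.neg_apply, LinearMap.comp_apply, hm, map_sub]; ring
      rw [e]
      rw [abs_le] at h1 h2 ⊢
      constructor <;> nlinarith) hρ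
  have hx' : ∀ y : V × W, |Θ (y₀ + L₁ v₀ + L₂ w₀) (m y)| ≤ ρ * ‖y‖ := by
    intro y
    have h := hx y
    rw [LinearMap.compl₁₂_apply, hp, LinearMap.neg_apply, LinearMap.comp_apply, sub_neg_eq_add,
      ← LinearMap.add_apply, ← map_add] at h
    rwa [add_assoc, add_comm y₀]
  set Y := y₀ + L₁ v₀ + L₂ w₀ with hY
  have hY₁ : ∀ h, |Θ Y (L₁ h)| ≤ ρ * √(Θ (L₁ h) (L₁ h)) := by
    intro h
    have e : ‖((h, 0) : V × W)‖ = √(Θ (L₁ h) (L₁ h)) := by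
      rw [← Real.sqrt_sq (norm_nonneg _), hnorm]; simp
    simpa [hm, e] using hx' (h, 0)
  have hY₂ : ∀ g, |Θ Y (L₂ g)| ≤ ρ * √(-Θ (L₂ g) (L₂ g)) := by
    intro g
    have e : ‖((0, g) : V × W)‖ = √(-Θ (L₂ g) (L₂ g)) := by
      rw [← Real.sqrt_sq (norm_nonneg _), hnorm]; simp
    simpa [hm, e] using hx' (0, g)
  have expand : ∀ h g, Θ (y₀ + L₁ (v₀ + h) + L₂ (w₀ + g)) (y₀ + L₁ (v₀ + h) + L₂ (w₀ + g)) =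
      Θ Y Y + 2 * Θ Y (L₁ h) + 2 * Θ Y (L₂ g) + Θ (L₁ h) (L₁ h) + Θ (L₂ g) (L₂ g)
        + 2 * Θ (L₁ h) (L₂ g) := by
    intro h g
    have e : y₀ + L₁ (v₀ + h) + L₂ (w₀ + g) = Y + L₁ h + L₂ g := by
      rw [hY, map_add, map_add]; abel
    rw [e]
    simp only [map_add, LinearMap.add_apply]
    rw [hsymm (L₁ h) Y, hsymm (L₂ g) Y, hsymm (L₂ g) (L₁ h)]
    ring
  -- For `w = w₀` the approximate stationarity in `v` puts the infimum within `ρ²` of the value at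
  -- `v₀`, and some `v` has value at most `ρ`.
  have hYY : Θ Y Y ≤ ρ + ρ ^ 2 := by
    obtain ⟨v, hv⟩ := hinf w₀ ρ hρ
    have h := expand (v - v₀) 0
    rw [add_sub_cancel, add_zero] at h
    have h1 := neg_le_of_abs_le (hY₁ (v - v₀))
    have h2 := Real.sq_sqrt (ha (v - v₀))
    simp only [map_zero, mul_zero, add_zero] at h
    nlinarith [sq_nonneg (√(Θ (L₁ (v - v₀)) (L₁ (v - v₀))) - ρ)]
  -- This radius makes both `s ≤ ρ` and `K * s ≤ ρ`; the terms linear in `τ` then add up to at most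
  -- `4ρτ`, which `-τ²` absorbs at the cost of `4ρ²`.
  refine ⟨v₀, (ρ / (1 + K)) ^ 2, by positivity, fun v hv w => ?_⟩
  have h := expand (v - v₀) (w - w₀)
  rw [add_sub_cancel, add_sub_cancel] at h
  rw [h]
  have h1 := le_of_abs_le (hY₁ (v - v₀))
  have h2 := le_of_abs_le (hY₂ (w - w₀))
  have h3 := le_of_abs_le (hr' (v - v₀) (w - w₀))
  have h4 := Real.sq_sqrt (ha (v - v₀))
  have h5 := Real.sq_sqrt (hb (w - w₀))
  have h6 : √(Θ (L₁ (v - v₀)) (L₁ (v - v₀))) ≤ ρ / (1 + K) :=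
    Real.sqrt_le_iff.2 ⟨by positivity, hv⟩
  have h7 := Real.sqrt_nonneg (Θ (L₁ (v - v₀)) (L₁ (v - v₀)))
  have h8 := Real.sqrt_nonneg (-Θ (L₂ (w - w₀)) (L₂ (w - w₀)))
  set s := √(Θ (L₁ (v - v₀)) (L₁ (v - v₀)))
  set τ := √(-Θ (L₂ (w - w₀)) (L₂ (w - w₀)))
  have h9 : s * (1 + K) ≤ ρ := (le_div_iff₀ (by positivity)).1 h6
  have h10 : K * s ≤ ρ := by nlinarith
  have h11 : s ≤ ρ := by nlinarith [mul_nonneg hK h7]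
  have h12 : K * s * τ ≤ ρ * τ := mul_le_mul_of_nonneg_right h10 h8
  nlinarith [sq_nonneg (τ - 2 * ρ), mul_le_mul_of_nonneg_left h11 hρ.le,
    mul_le_mul h11 h11 h7 hρ.le]

/-! ### Responses of a stable linear system -/

theorem impulse_zero : impulse 0 = 1 := by simp [impulse]

theorem impulse_succ (t : ℕ) : impulse (t + 1) = 0 := by simp [impulse]

section Responses

variable {n m : Type*} [Fintype n] [DecidableEq n] [Fintype m] [DecidableEq m]

/-- The polynomial matrix `1 - λ A`. -/
noncomputable def pencil (A : Matrix n n ℂ) : Matrix n n ℂ[X] := 1 - (X : ℂ[X]) • A.map C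

theorem pencil_map_eval (A : Matrix n n ℂ) (l : ℂ) : (pencil A).map (eval l) = 1 - l • A := by
  ext i j
  by_cases hij : i = j <;> simp [pencil, one_apply, hij, mul_comm l]

/-- The polynomial `det (1 - λ A)`. -/
noncomputable def charDen (A : Matrix n n ℂ) : ℂ[X] := (pencil A).det

theorem charDen_eval (A : Matrix n n ℂ) (l : ℂ) : (charDen A).eval l = (1 - l • A).det := by
  rw [← pencil_map_eval]
  exact (evalRingHom l).map_det _

/-- The substitution `λ = z⁻¹` carries the exterior of the disc to its interior, `λ = 0` being
trivial. Hence `det (1 - S A)` is an invertible operator. -/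
theorem charDen_eval_ne_zero {A : Matrix n n ℂ}
    (hA : ∀ z : ℂ, 1 ≤ ‖z‖ → (z • (1 : Matrix n n ℂ) - A).det ≠ 0) {l : ℂ} (hl : ‖l‖ ≤ 1) :
    (charDen A).eval l ≠ 0 := by
  rw [charDen_eval]
  rcases eq_or_ne l 0 with rfl | hl0
  · simp
  · have h : (1 : Matrix n n ℂ) - l • A = l • (l⁻¹ • (1 : Matrix n n ℂ) - A) := by
      rw [smul_sub, smul_smul, mul_inv_cancel₀ hl0, one_smul]
    rw [h, det_smul]
    refine mul_ne_zero (pow_ne_zero _ hl0) (hA _ ?_)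
    rw [norm_inv]
    exact (one_le_inv₀ (norm_pos_iff.2 hl0)).2 hl

/-- The inverse of the operator `det (1 - S A)`, where `S` is the shift. -/
noncomputable def invDen (A : Matrix n n ℂ) : SeqHilbert →L[ℂ] SeqHilbert :=
  Ring.inverse (aeval shift (charDen A))

section

variable {A : Matrix n n ℂ} (hA : ∀ z : ℂ, 1 ≤ ‖z‖ → (z • (1 : Matrix n n ℂ) - A).det ≠ 0)
include hA

theorem aeval_charDen_invDen (u : SeqHilbert) : aeval shift (charDen A) (invDen A u) = u := by
  have h := Ring.mul_inverse_cancel _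
    (isUnit_aeval_shift (charDen A) fun l hl => charDen_eval_ne_zero hA hl)
  exact congrArg (fun T : SeqHilbert →L[ℂ] SeqHilbert => T u) h

end

/-- The solution of `x(t+1) = A x(t)`, `x(0) = ξ`. -/
noncomputable def freeResponse (A : Matrix n n ℂ) (ξ : n → ℂ) : n → SeqHilbert :=
  polyAct (pencil A).adjugate fun j => invDen A (ξ j • impulse)

/-- The polynomial numerator of the transfer matrix from inputs to states and inputs, the
denominator being `det (1 - λ A)`. -/
noncomputable def ioMatrix (A : Matrix n n ℂ) (B : Matrix n m ℂ) : Matrix (n ⊕ m) m ℂ[X] :=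
  fromRows ((X : ℂ[X]) • ((pencil A).adjugate * B.map C)) (charDen A • 1)

/-- The square summable solution of `x(t+1) = A x(t) + B u(t)`, `x(0) = 0`, together with `u`. -/
noncomputable def response (A : Matrix n n ℂ) (B : Matrix n m ℂ) (u : m → SeqHilbert) :
    n ⊕ m → SeqHilbert :=
  polyAct (ioMatrix A B) fun j => invDen A (u j)

theorem polyAct_pencil (A : Matrix n n ℂ) (x : n → SeqHilbert) (i : n) :
    polyAct (pencil A) x i = x i - shift (∑ j, A i j • x j) := by
  have h : ∀ j, aeval shift (pencil A i j) (x j) =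
      (if i = j then x j else 0) - shift (A i j • x j) := by
    intro j
    by_cases hij : i = j <;>
      simp [pencil, one_apply, hij, _root_.sub_apply, Algebra.algebraMap_eq_smul_one, mul_comm (X : ℂ[X])]
  rw [polyAct_apply, Finset.sum_congr rfl fun j _ => h j, Finset.sum_sub_distrib, map_sum]
  simp

section

variable {A : Matrix n n ℂ} (hA : ∀ z : ℂ, 1 ≤ ‖z‖ → (z • (1 : Matrix n n ℂ) - A).det ≠ 0)
include hA

theorem freeResponse_eq (ξ : n → ℂ) (i : n) :
    freeResponse A ξ i = ξ i • impulse + shift (∑ j, A i j • freeResponse A ξ j) := by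
  rw [← sub_eq_iff_eq_add, ← polyAct_pencil, freeResponse, ← polyAct_mul, mul_adjugate,
    polyAct_smul_one]
  exact aeval_charDen_invDen hA _

theorem freeResponse_apply (ξ : n → ℂ) (i : n) (t : ℕ) :
    freeResponse A ξ i t = (A ^ t *ᵥ ξ) i := by
  induction t generalizing i with
  | zero =>
    rw [freeResponse_eq hA, lp.coeFn_add, Pi.add_apply, shift_zero, lp.coeFn_smul, Pi.smul_apply,
      impulse_zero]
    simp
  | succ t ih =>
    rw [freeResponse_eq hA, lp.coeFn_add, Pi.add_apply, shift_succ, lp.coeFn_smul, Pi.smul_apply,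
      impulse_succ, seqHilbert_sum_apply, pow_succ', ← mulVec_mulVec]
    simp only [lp.coeFn_smul, Pi.smul_apply, ih]
    simp [mulVec, dotProduct]

theorem response_inr (B : Matrix n m ℂ) (u : m → SeqHilbert) (j : m) :
    response A B u (Sum.inr j) = u j := by
  have h : response A B u (Sum.inr j) = polyAct (charDen A • (1 : Matrix m m ℂ[X]))
      (fun j => invDen A (u j)) j := by
    simp only [response, polyAct_apply]; rfl
  rw [h, polyAct_smul_one, aeval_charDen_invDen hA]

theorem response_inl_eq (B : Matrix n m ℂ) (u : m → SeqHilbert) (i : n) :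
    response A B u (Sum.inl i) =
      shift (∑ j, A i j • response A B u (Sum.inl j) + ∑ j, B i j • u j) := by
  have h : (fun i => response A B u (Sum.inl i)) =
      polyAct ((X : ℂ[X]) • ((pencil A).adjugate * B.map C)) (fun j => invDen A (u j)) := by
    ext1 i
    simp only [response, polyAct_apply]; rfl
  rw [map_add, ← sub_eq_iff_eq_add', ← polyAct_pencil A (fun i => response A B u (Sum.inl i)), h,
    ← polyAct_mul, Matrix.mul_smul, ← Matrix.mul_assoc, mul_adjugate, polyAct_apply, map_sum]
  refine Finset.sum_congr rfl fun j _ => ?_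
  have e : ((X : ℂ[X]) • ((pencil A).det • (1 : Matrix n n ℂ[X]) * B.map C)) i j =
      X * C (B i j) * charDen A := by
    simp [charDen]; ring
  rw [e, map_mul, mul_apply_eq_comp, aeval_charDen_invDen hA]
  simp [Algebra.algebraMap_eq_smul_one]

theorem response_inl_zero (B : Matrix n m ℂ) (u : m → SeqHilbert) (i : n) :
    response A B u (Sum.inl i) 0 = 0 := by
  rw [response_inl_eq hA]; rfl

theorem response_inl_succ (B : Matrix n m ℂ) (u : m → SeqHilbert) (i : n) (t : ℕ) :
    response A B u (Sum.inl i) (t + 1) =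
      ∑ j, A i j * response A B u (Sum.inl j) t + ∑ j, B i j * u j t := by
  rw [response_inl_eq hA, shift_succ, lp.coeFn_add, Pi.add_apply, seqHilbert_sum_apply,
    seqHilbert_sum_apply]
  rfl

/-- The adjoint shift maps the free response of `η` to that of `A η`, so `S* - ā` acts on initial
states as `A - ā`. This is invertible because `|a| ≥ 1` and `A` is Schur; the roots of `s` are
treated one at a time. -/
theorem exists_freeResponse_eq_adjoint (s : ℂ[X]) (hs : ∀ l : ℂ, ‖l‖ < 1 → s.eval l ≠ 0)
    (ξ : n → ℂ) : ∃ η : n → ℂ, ∀ i, freeResponse A ξ i =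
      ContinuousLinearMap.adjoint (aeval shift s) (freeResponse A η i) := by
  have hs0 : s ≠ 0 := by rintro rfl; exact hs 0 (by simp) (by simp)
  revert hs ξ
  refine nonzero_polynomial_induction (P := fun s => (∀ l : ℂ, ‖l‖ < 1 → s.eval l ≠ 0) →
    ∀ ξ : n → ℂ, ∃ η : n → ℂ, ∀ i, freeResponse A ξ i =
      ContinuousLinearMap.adjoint (aeval shift s) (freeResponse A η i)) ?_ ?_ s hs0
  · intro c hc _ ξ
    refine ⟨((starRingEnd ℂ) c)⁻¹ • ξ, fun i => ?_⟩
    have hc' : (starRingEnd ℂ) c ≠ 0 := by simpa using hc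
    rw [aeval_C, Algebra.algebraMap_eq_smul_one, map_smulₛₗ, ContinuousLinearMap.one_def,
      ContinuousLinearMap.adjoint_id]
    ext t
    change _ = (starRingEnd ℂ) c * freeResponse A (((starRingEnd ℂ) c)⁻¹ • ξ) i t
    rw [freeResponse_apply hA, freeResponse_apply hA, mulVec_smul, Pi.smul_apply, smul_eq_mul,
      mul_inv_cancel_left₀ hc']
  · intro a s _ ih h ξ
    have ha : 1 ≤ ‖a‖ := by
      by_contra hlt
      exact h a (not_le.1 hlt) (by simp)
    obtain ⟨ζ, hζ⟩ := ih (fun l hl h0 => h l hl (by simp [h0])) ξ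
    obtain ⟨η, hη⟩ : ∃ η : n → ℂ, A *ᵥ η - (starRingEnd ℂ) a • η = ζ := by
      let M := (starRingEnd ℂ) a • (1 : Matrix n n ℂ) - A
      have hM : IsUnit M.det := Ne.isUnit (hA ((starRingEnd ℂ) a) (by rwa [RCLike.norm_conj]))
      refine ⟨-(M⁻¹ *ᵥ ζ), ?_⟩
      have h1 : M *ᵥ (M⁻¹ *ᵥ ζ) = ζ := by
        rw [mulVec_mulVec, mul_nonsing_inv _ hM, one_mulVec]
      rw [sub_mulVec, smul_mulVec, one_mulVec] at h1
      rw [mulVec_neg, smul_neg]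
      linear_combination h1
    refine ⟨η, fun i => ?_⟩
    have e : freeResponse A ζ i =
        ContinuousLinearMap.adjoint (aeval shift (X - C a)) (freeResponse A η i) := by
      rw [aeval_X_sub_C_shift, Algebra.algebraMap_eq_smul_one, map_sub, map_smulₛₗ,
        ContinuousLinearMap.one_def, ContinuousLinearMap.adjoint_id]
      ext t
      change _ = ContinuousLinearMap.adjoint shift (freeResponse A η i) t -
        (starRingEnd ℂ) a * freeResponse A η i t
      rw [adjoint_shift_apply, freeResponse_apply hA, freeResponse_apply hA, freeResponse_apply hA,
        ← hη, mulVec_sub, mulVec_smul, pow_succ, mulVec_mulVec]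
      rfl
    have e' : ContinuousLinearMap.adjoint (aeval shift ((X - C a) * s)) =
        (ContinuousLinearMap.adjoint (aeval shift s)).comp
          (ContinuousLinearMap.adjoint (aeval shift (X - C a))) := by
      rw [map_mul, ← ContinuousLinearMap.adjoint_comp]
      rfl
    rw [hζ, e, e', ContinuousLinearMap.comp_apply]

end

end Responses

/-- A functional given by an element of the range of the adjoint of `p(S)` is bounded by the
seminorm `‖p(S) v‖`. -/
theorem exists_sesq_polyAct_le {κ ι : Type*} [Fintype κ] [Fintype ι] (Y : Matrix κ ι ℂ[X])
    (Q : Matrix κ κ ℂ) (p : ℂ[X]) (y y' : κ → SeqHilbert)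
    (hy : ∀ i, y i = ContinuousLinearMap.adjoint (aeval shift p) (y' i)) :
    ∃ K : ℝ, ∀ v : ι → SeqHilbert,
      ‖sesq Q y (polyAct Y v)‖ ^ 2 ≤ K ^ 2 * ∑ i, ‖aeval shift p (v i)‖ ^ 2 := by
  let f : (ι → SeqHilbert) →L[ℂ] ℂ := (sesq Q y').comp (polyAct Y)
  refine ⟨‖f‖, fun v => ?_⟩
  -- The adjoint moves to the other side, and `p(S)` commutes with the polynomial matrix `Y(S)`.
  have e : sesq Q y (polyAct Y v) = f fun i => aeval shift p (v i) := by
    simp only [f, ContinuousLinearMap.comp_apply, sesq_apply, hy]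
    refine Finset.sum_congr rfl fun i _ => Finset.sum_congr rfl fun j _ => ?_
    rw [ContinuousLinearMap.adjoint_inner_left, polyAct_comm Y (aeval_shift_comm · p)]
  have h1 : ‖fun i => aeval shift p (v i)‖ ≤ √(∑ i, ‖aeval shift p (v i)‖ ^ 2) := by
    refine (pi_norm_le_iff_of_nonneg (Real.sqrt_nonneg _)).2 fun i => ?_
    refine Real.le_sqrt_of_sq_le ?_
    exact Finset.single_le_sum (f := fun i => ‖aeval shift p (v i)‖ ^ 2)
      (fun _ _ => by positivity) (Finset.mem_univ i)
  have h2 : ‖sesq Q y (polyAct Y v)‖ ≤ ‖f‖ * √(∑ i, ‖aeval shift p (v i)‖ ^ 2) := by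
    rw [e]
    exact (f.le_opNorm _).trans (mul_le_mul_of_nonneg_left h1 (norm_nonneg _))
  calc _ ≤ (‖f‖ * √(∑ i, ‖aeval shift p (v i)‖ ^ 2)) ^ 2 := by gcongr
    _ = _ := by rw [mul_pow, Real.sq_sqrt (Finset.sum_nonneg fun _ _ => by positivity)]

/-! ### From the frequency conditions to bounds in the time domain -/

section Frequency

variable {n m : Type*} [Fintype n] [DecidableEq n] [Fintype m] [DecidableEq m]

theorem ioMatrix_map_eval {A : Matrix n n ℂ}
    (hA : ∀ z : ℂ, 1 ≤ ‖z‖ → (z • (1 : Matrix n n ℂ) - A).det ≠ 0) (B : Matrix n m ℂ) {l : ℂ}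
    (hl : ‖l‖ = 1) : (ioMatrix A B).map (eval l) =
      (charDen A).eval l • fromRows ((l⁻¹ • (1 : Matrix n n ℂ) - A)⁻¹ * B) 1 := by
  have hl0 : l ≠ 0 := by rintro rfl; simp at hl
  set M := l⁻¹ • (1 : Matrix n n ℂ) - A with hM
  have hdet : IsUnit M.det := Ne.isUnit (hA _ (by rw [norm_inv, hl, inv_one]))
  have hadj : (pencil A).adjugate.map (eval l) = (1 - l • A).adjugate := by
    rw [← pencil_map_eval]
    exact RingHom.map_adjugate (evalRingHom l) (pencil A)
  have h1 : M * (l • (1 - l • A).adjugate) = (charDen A).eval l • (1 : Matrix n n ℂ) := by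
    have h2 : 1 - l • A = l • M := by
      rw [hM, smul_sub, smul_smul, mul_inv_cancel₀ hl0, one_smul]
    rw [charDen_eval, ← mul_adjugate, Matrix.mul_smul, ← Matrix.smul_mul, ← h2]
  have h2 : l • (1 - l • A).adjugate = (charDen A).eval l • M⁻¹ := by
    have h := congrArg (fun N => M⁻¹ * N) h1
    simpa [nonsing_inv_mul_cancel_left _ _ hdet] using h
  have h3 : ((X : ℂ[X]) • ((pencil A).adjugate * B.map C)).map (eval l) =
      (charDen A).eval l • (M⁻¹ * B) := by
    rw [← Matrix.smul_mul ((charDen A).eval l), ← h2, Matrix.smul_mul, ← hadj]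
    ext i j
    simp [Matrix.mul_apply, eval_finsetSum]
  ext (i | i) j
  · exact congrFun (congrFun h3 i) j
  · by_cases hij : i = j <;> simp [ioMatrix, one_apply, hij]

/-- The linear term is controlled by `‖p(S)v‖`, hence by the possibly degenerate quadratic form. As
`Q` need not be symmetric, the two orders of arguments are bounded separately, the second through
`Qᴴ`. -/
theorem exists_bound_of_posSemidef {ι : Type*} [Fintype ι] [DecidableEq ι] {A : Matrix n n ℂ}
    (hA : ∀ z : ℂ, 1 ≤ ‖z‖ → (z • (1 : Matrix n n ℂ) - A).det ≠ 0)
    (Y : Matrix (n ⊕ m) ι ℂ[X]) (Q : Matrix (n ⊕ m) (n ⊕ m) ℂ)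
    (hpsd : ∀ l : ℂ, ‖l‖ = 1 → ((Y.map (eval l))ᴴ * Q * Y.map (eval l)).PosSemidef)
    {l₀ : ℂ} (hl₀ : ‖l₀‖ = 1) (hpd : ((Y.map (eval l₀))ᴴ * Q * Y.map (eval l₀)).PosDef)
    (ξ : n → ℂ) :
    (∀ v, 0 ≤ (sesq Q (polyAct Y v) (polyAct Y v)).re) ∧ ∃ K : ℝ, 0 ≤ K ∧ ∀ v,
      ((sesq Q (Sum.elim (freeResponse A ξ) 0) (polyAct Y v)).re
        + (sesq Q (polyAct Y v) (Sum.elim (freeResponse A ξ) 0)).re) ^ 2 ≤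
      K * (sesq Q (polyAct Y v) (polyAct Y v)).re := by
  obtain ⟨c, hc, p, hp, hle⟩ := exists_outer_lower_bound Y Q hpsd hl₀ hpd
  have hlow := le_re_sesq_of_lower_bound Y Q c p hle
  obtain ⟨η, hη⟩ := exists_freeResponse_eq_adjoint hA p hp ξ
  have hy : ∀ i, (Sum.elim (freeResponse A ξ) 0 : n ⊕ m → SeqHilbert) i =
      ContinuousLinearMap.adjoint (aeval shift p) (Sum.elim (freeResponse A η) 0 i) := by
    rintro (i | i)
    · exact hη i
    · simp
  obtain ⟨K₁, h₁⟩ := exists_sesq_polyAct_le Y Q p _ _ hy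
  obtain ⟨K₂, h₂⟩ := exists_sesq_polyAct_le Y Qᴴ p _ _ hy
  refine ⟨fun v => le_trans (by positivity) (hlow v), 2 * (K₁ ^ 2 + K₂ ^ 2) / c, by positivity,
    fun v => ?_⟩
  have e : (sesq Q (polyAct Y v) (Sum.elim (freeResponse A ξ) 0)).re =
      (sesq Qᴴ (Sum.elim (freeResponse A ξ) 0) (polyAct Y v)).re := by
    rw [← sesq_conj, Complex.conj_re]
  have hsq : ∀ z : ℂ, z.re ^ 2 ≤ ‖z‖ ^ 2 := fun z =>
    sq_le_sq' (neg_le_of_abs_le (Complex.abs_re_le_norm z)) (Complex.re_le_norm z)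
  have h3 := (hsq _).trans (h₁ v)
  have h4 := (hsq _).trans (h₂ v)
  rw [e]
  set a := (sesq Q (Sum.elim (freeResponse A ξ) 0) (polyAct Y v)).re
  set b := (sesq Qᴴ (Sum.elim (freeResponse A ξ) 0) (polyAct Y v)).re
  set s := ∑ i, ‖aeval shift p (v i)‖ ^ 2
  calc (a + b) ^ 2 ≤ 2 * (a ^ 2 + b ^ 2) := by nlinarith [sq_nonneg (a - b)]
    _ ≤ 2 * (K₁ ^ 2 + K₂ ^ 2) / c * (c * s) := by
        have : 2 * (K₁ ^ 2 + K₂ ^ 2) / c * (c * s) = 2 * (K₁ ^ 2 * s + K₂ ^ 2 * s) := by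
          field_simp
        rw [this]; linarith
    _ ≤ _ := mul_le_mul_of_nonneg_left (hlow v) (by positivity)

/-- Minimum phase systems have dense range. -/
theorem exists_approx_output {k : Type*} [Fintype k] [DecidableEq k] (A : Matrix n n ℂ)
    (B : Matrix n k ℂ) (E : Matrix k n ℂ) (D : Matrix k k ℂ)
    (h : ∀ l : ℂ, ‖l‖ < 1 → (fromBlocks (l • A - 1) (l • B) E D).det ≠ 0)
    (g : k → SeqHilbert) {δ : ℝ} (hδ : 0 < δ) :
    ∃ (x : n → SeqHilbert) (u : k → SeqHilbert),
      (∀ i, x i = shift (∑ j, A i j • x j + ∑ j, B i j • u j)) ∧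
      ∀ i, ‖g i + (∑ j, E i j • x j + ∑ j, D i j • u j)‖ < δ := by
  let M : Matrix (n ⊕ k) (n ⊕ k) ℂ[X] :=
    fromBlocks ((X : ℂ[X]) • A.map C - 1) ((X : ℂ[X]) • B.map C) (E.map C) (D.map C)
  have heval : ∀ l : ℂ, M.det.eval l = (fromBlocks (l • A - 1) (l • B) E D).det := by
    intro l
    have h1 : M.map (eval l) = fromBlocks (l • A - 1) (l • B) E D := by
      ext (i | i) (j | j)
      · by_cases hij : i = j <;> simp [M, one_apply, hij, mul_comm l]
      all_goals simp [M, mul_comm l]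
    rw [← h1]
    exact (evalRingHom l).map_det M
  have hdense := denseRange_aeval_shift M.det fun l hl => by rw [heval]; exact h l hl
  have happ : ∀ i, ∃ b, ‖g i + aeval shift M.det b‖ < δ := by
    intro i
    obtain ⟨b, hb⟩ := hdense.exists_dist_lt (-g i) hδ
    refine ⟨b, ?_⟩
    rwa [dist_eq_norm, ← norm_neg, neg_sub, sub_neg_eq_add, add_comm] at hb
  choose b hb using happ
  -- Applying `M(S)` gives `det M(S)` times `(0, b)`: the upper rows become the state equation with
  -- zero initial state, and the lower rows say that the output is `det M(S) b`.
  set z := polyAct M.adjugate (Sum.elim 0 b) with hz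
  have hMz : ∀ i, polyAct M z i = aeval shift M.det (Sum.elim 0 b i) := by
    intro i
    rw [hz, ← polyAct_mul, mul_adjugate, polyAct_smul_one]
  refine ⟨fun i => z (Sum.inl i), fun i => z (Sum.inr i), fun i => ?_, fun i => ?_⟩
  · have h1 := hMz (Sum.inl i)
    rw [polyAct_apply, Fintype.sum_sum_type, Sum.elim_inl, Pi.zero_apply, map_zero] at h1
    have h2 : ∀ j, aeval shift (M (Sum.inl i) (Sum.inl j)) (z (Sum.inl j)) =
        shift (A i j • z (Sum.inl j)) - if i = j then z (Sum.inl j) else 0 := by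
      intro j
      by_cases hij : i = j <;> simp [M, one_apply, hij, _root_.sub_apply,
        Algebra.algebraMap_eq_smul_one, mul_comm (X : ℂ[X])]
    have h3 : ∀ j, aeval shift (M (Sum.inl i) (Sum.inr j)) (z (Sum.inr j)) =
        shift (B i j • z (Sum.inr j)) := by
      intro j
      simp [M, Algebra.algebraMap_eq_smul_one, mul_comm (X : ℂ[X])]
    simp only [h2, h3, Finset.sum_sub_distrib, Finset.sum_ite_eq, Finset.mem_univ, if_true] at h1
    rw [map_add, map_sum, map_sum]
    rw [sub_add_eq_add_sub, sub_eq_zero] at h1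
    exact h1.symm
  · have h1 := hMz (Sum.inr i)
    rw [polyAct_apply, Fintype.sum_sum_type, Sum.elim_inr] at h1
    have h2 : ∀ j, aeval shift (M (Sum.inr i) (Sum.inl j)) (z (Sum.inl j)) =
        E i j • z (Sum.inl j) := by
      intro j
      simp [M, Algebra.algebraMap_eq_smul_one]
    have h3 : ∀ j, aeval shift (M (Sum.inr i) (Sum.inr j)) (z (Sum.inr j)) =
        D i j • z (Sum.inr j) := by
      intro j
      simp [M, Algebra.algebraMap_eq_smul_one]
    simp only [h2, h3] at h1
    rw [h1]
    exact hb i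

end Frequency

/-! ### Splitting the transfer matrix between the two inputs -/

section Blocks

variable {n k q : ℕ} {A : Matrix (Fin n) (Fin n) ℝ} (B₁ : Matrix (Fin n) (Fin k) ℝ)
  (B₂ : Matrix (Fin n) (Fin q) ℝ)

/-- The columns of the numerator matrix that belong to the first input. -/
noncomputable def ioMatrix₁ (A : Matrix (Fin n) (Fin n) ℝ) (B₁ : Matrix (Fin n) (Fin k) ℝ)
    (B₂ : Matrix (Fin n) (Fin q) ℝ) : Matrix (Fin n ⊕ (Fin k ⊕ Fin q)) (Fin k) ℂ[X] :=
  (ioMatrix (toC A) (toC (fromCols B₁ B₂))).toCols₁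

/-- The columns of the numerator matrix that belong to the second input. -/
noncomputable def ioMatrix₂ (A : Matrix (Fin n) (Fin n) ℝ) (B₁ : Matrix (Fin n) (Fin k) ℝ)
    (B₂ : Matrix (Fin n) (Fin q) ℝ) : Matrix (Fin n ⊕ (Fin k ⊕ Fin q)) (Fin q) ℂ[X] :=
  (ioMatrix (toC A) (toC (fromCols B₁ B₂))).toCols₂

theorem polyAct_ioMatrix_add (v : Fin k → SeqHilbert) (w : Fin q → SeqHilbert) :
    polyAct (ioMatrix₁ A B₁ B₂) (fun j => invDen (toC A) (v j))
      + polyAct (ioMatrix₂ A B₁ B₂) (fun j => invDen (toC A) (w j)) =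
      response (toC A) (toC (fromCols B₁ B₂)) (Sum.elim v w) := by
  ext1 i
  simp only [Pi.add_apply, response, polyAct_apply, Fintype.sum_sum_type, Sum.elim_inl,
    Sum.elim_inr]
  rfl

/-- Clearing the denominator only multiplies `Π` by the positive scalar `|det (1 - λ A)|²`, so
definiteness passes to the polynomial numerator. -/
theorem ioMatrix_form_eq (hA : IsSchur A)
    (Q : Matrix (Fin n ⊕ (Fin k ⊕ Fin q)) (Fin n ⊕ (Fin k ⊕ Fin q)) ℝ) {l : ℂ} (hl : ‖l‖ = 1) :
    ((ioMatrix (toC A) (toC (fromCols B₁ B₂))).map (eval l))ᴴ * toC Q *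
      (ioMatrix (toC A) (toC (fromCols B₁ B₂))).map (eval l) =
      ((‖(charDen (toC A)).eval l‖ ^ 2 : ℝ) : ℂ) • freqMatrix A B₁ B₂ Q l⁻¹ := by
  rw [ioMatrix_map_eval hA _ hl, freqMatrix, conjTranspose_smul, Matrix.smul_mul, Matrix.smul_mul,
    Matrix.mul_smul, smul_smul, RCLike.star_def, Complex.conj_mul']
  norm_cast

theorem ioMatrix_blocks_posSemidef (hA : IsSchur A)
    (Q : Matrix (Fin n ⊕ (Fin k ⊕ Fin q)) (Fin n ⊕ (Fin k ⊕ Fin q)) ℝ) {ε : ℝ} {z₀ : ℂ}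
    (hz₀ : ‖z₀‖ = 1) (h : MinimaxFrequencyCondition A B₁ B₂ Q ε z₀) :
    (∀ l : ℂ, ‖l‖ = 1 → (fromBlocks
      (((ioMatrix₁ A B₁ B₂).map (eval l))ᴴ * toC Q * (ioMatrix₁ A B₁ B₂).map (eval l))
      ((ε : ℂ) • (((ioMatrix₁ A B₁ B₂).map (eval l))ᴴ * toC Q * (ioMatrix₂ A B₁ B₂).map (eval l)))
      ((ε : ℂ) • (((ioMatrix₂ A B₁ B₂).map (eval l))ᴴ * toC Q * (ioMatrix₁ A B₁ B₂).map (eval l)))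
      (-(((ioMatrix₂ A B₁ B₂).map (eval l))ᴴ * toC Q *
        (ioMatrix₂ A B₁ B₂).map (eval l)))).PosSemidef) ∧
    (((ioMatrix₁ A B₁ B₂).map (eval z₀⁻¹))ᴴ * toC Q *
      (ioMatrix₁ A B₁ B₂).map (eval z₀⁻¹)).PosDef ∧
    (-(((ioMatrix₂ A B₁ B₂).map (eval z₀⁻¹))ᴴ * toC Q *
      (ioMatrix₂ A B₁ B₂).map (eval z₀⁻¹))).PosDef := by
  have e₁₁ : ∀ l : ℂ, ‖l‖ = 1 → ((ioMatrix₁ A B₁ B₂).map (eval l))ᴴ * toC Q *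
      (ioMatrix₁ A B₁ B₂).map (eval l) = ((‖(charDen (toC A)).eval l‖ ^ 2 : ℝ) : ℂ) •
        (freqMatrix A B₁ B₂ Q l⁻¹).toBlocks₁₁ := fun l hl =>
    congrArg toBlocks₁₁ (ioMatrix_form_eq B₁ B₂ hA Q hl)
  have e₁₂ : ∀ l : ℂ, ‖l‖ = 1 → ((ioMatrix₁ A B₁ B₂).map (eval l))ᴴ * toC Q *
      (ioMatrix₂ A B₁ B₂).map (eval l) = ((‖(charDen (toC A)).eval l‖ ^ 2 : ℝ) : ℂ) •
        (freqMatrix A B₁ B₂ Q l⁻¹).toBlocks₁₂ := fun l hl =>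
    congrArg toBlocks₁₂ (ioMatrix_form_eq B₁ B₂ hA Q hl)
  have e₂₁ : ∀ l : ℂ, ‖l‖ = 1 → ((ioMatrix₂ A B₁ B₂).map (eval l))ᴴ * toC Q *
      (ioMatrix₁ A B₁ B₂).map (eval l) = ((‖(charDen (toC A)).eval l‖ ^ 2 : ℝ) : ℂ) •
        (freqMatrix A B₁ B₂ Q l⁻¹).toBlocks₂₁ := fun l hl =>
    congrArg toBlocks₂₁ (ioMatrix_form_eq B₁ B₂ hA Q hl)
  have e₂₂ : ∀ l : ℂ, ‖l‖ = 1 → ((ioMatrix₂ A B₁ B₂).map (eval l))ᴴ * toC Q *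
      (ioMatrix₂ A B₁ B₂).map (eval l) = ((‖(charDen (toC A)).eval l‖ ^ 2 : ℝ) : ℂ) •
        (freqMatrix A B₁ B₂ Q l⁻¹).toBlocks₂₂ := fun l hl =>
    congrArg toBlocks₂₂ (ioMatrix_form_eq B₁ B₂ hA Q hl)
  have hz₀' : ‖z₀⁻¹‖ = 1 := by rw [norm_inv, hz₀, inv_one]
  have hpos : ∀ l : ℂ, ‖l‖ = 1 → (0 : ℂ) < ((‖(charDen (toC A)).eval l‖ ^ 2 : ℝ) : ℂ) := by
    intro l hl
    have := norm_pos_iff.2 (charDen_eval_ne_zero hA hl.le)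
    exact Complex.zero_lt_real.2 (by positivity)
  obtain ⟨h1, h2, h3⟩ := h
  refine ⟨fun l hl => ?_, ?_, ?_⟩
  · rw [e₁₁ l hl, e₁₂ l hl, e₂₁ l hl, e₂₂ l hl, smul_comm (ε : ℂ), smul_comm (ε : ℂ), ← smul_neg,
      ← fromBlocks_smul]
    exact (h1 l⁻¹ (by rw [norm_inv, hl, inv_one])).smul (hpos l hl).le
  · rw [e₁₁ _ hz₀', inv_inv]
    exact h2.smul (hpos _ hz₀')
  · rw [e₂₂ _ hz₀', inv_inv, ← smul_neg]
    exact h3.smul (hpos _ hz₀')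

end Blocks

/-! ### Real signals -/

theorem norm_sq_eq_sum_of_euclidean {m : ℕ} (x : EuclideanSpace ℝ (Fin m)) :
    ‖x‖ ^ 2 = ∑ i, (x i) ^ 2 := by
  rw [EuclideanSpace.norm_sq_eq]; simp

theorem norm_coord_sq_le {m : ℕ} (x : EuclideanSpace ℝ (Fin m)) (i : Fin m) :
    ‖((x i : ℝ) : ℂ)‖ ^ 2 ≤ ‖x‖ ^ 2 := by
  rw [norm_sq_eq_sum_of_euclidean, Complex.norm_real, Real.norm_eq_abs, sq_abs]
  exact Finset.single_le_sum (f := fun i => (x i) ^ 2) (fun _ _ => sq_nonneg _) (Finset.mem_univ i)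

/-- A coordinate of a real signal, as a complex sequence. -/
noncomputable def coord {m : ℕ} (v : SqSumSignal m) (i : Fin m) : SeqHilbert :=
  ⟨fun t => ((v t i : ℝ) : ℂ), (memℓp_two_iff _).2 (Summable.of_nonneg_of_le
    (fun _ => by positivity) (fun t => norm_coord_sq_le (v t) i) (hasSum_norm_sq v).summable)⟩

theorem coord_apply {m : ℕ} (v : SqSumSignal m) (i : Fin m) (t : ℕ) :
    coord v i t = ((v t i : ℝ) : ℂ) := rfl

theorem norm_coord_le {m : ℕ} (v : SqSumSignal m) (i : Fin m) : ‖coord v i‖ ≤ ‖v‖ :=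
  le_of_sq_le_sq (hasSum_le (fun t => norm_coord_sq_le (v t) i) (hasSum_norm_sq (coord v i))
    (hasSum_norm_sq v)) (norm_nonneg v)

theorem coord_add {m : ℕ} (v w : SqSumSignal m) (i : Fin m) :
    coord (v + w) i = coord v i + coord w i := by
  ext t
  exact Complex.ofReal_add (v t i) (w t i)

theorem real_smul_seqHilbert (c : ℝ) (y : SeqHilbert) : c • y = (c : ℂ) • y := by
  ext t
  exact Complex.real_smul

theorem coord_smul {m : ℕ} (c : ℝ) (v : SqSumSignal m) (i : Fin m) :
    coord (c • v) i = c • coord v i := by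
  rw [real_smul_seqHilbert]
  ext t
  exact Complex.ofReal_mul c (v t i)

/-- The complex coordinate sequences of a real signal. -/
noncomputable def coords (m : ℕ) : SqSumSignal m →L[ℝ] (Fin m → SeqHilbert) :=
  LinearMap.mkContinuous
    { toFun := coord
      map_add' := fun v w => funext (coord_add v w)
      map_smul' := fun c v => funext (coord_smul c v) } 1 (fun v => by
    rw [one_mul]
    exact (pi_norm_le_iff_of_nonneg (norm_nonneg v)).2 (norm_coord_le v))

theorem coords_apply {m : ℕ} (v : SqSumSignal m) (i : Fin m) (t : ℕ) :
    coords m v i t = ((v t i : ℝ) : ℂ) := rfl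

/-- The real part of a vector of complex sequences. -/
noncomputable def realPart {m : ℕ} (u : Fin m → SeqHilbert) : SqSumSignal m :=
  ⟨fun t => WithLp.toLp 2 fun i => (u i t).re, (memℓp_two_iff _).2 (by
    refine Summable.of_nonneg_of_le (fun _ => by positivity) (fun t => ?_)
      (hasSum_sum fun (i : Fin m) (_ : i ∈ Finset.univ) => hasSum_norm_sq (u i)).summable
    rw [norm_sq_eq_sum_of_euclidean]
    exact Finset.sum_le_sum fun i _ => sq_le_sq' (neg_le_of_abs_le (Complex.abs_re_le_norm _))
      (Complex.re_le_norm _))⟩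

theorem realPart_apply {m : ℕ} (u : Fin m → SeqHilbert) (t : ℕ) (i : Fin m) :
    realPart u t i = (u i t).re := rfl

/-- A signal without its first `N` entries. -/
noncomputable def tail {m : ℕ} (N : ℕ) (v : SqSumSignal m) : SqSumSignal m :=
  ⟨fun t => v (t + N), (memℓp_two_iff _).2
    ((summable_nat_add_iff (f := fun t => ‖v t‖ ^ 2) N).2 (hasSum_norm_sq v).summable)⟩

theorem tail_apply {m : ℕ} (N : ℕ) (v : SqSumSignal m) (t : ℕ) : tail N v t = v (t + N) := rfl

theorem norm_tail_sub_le {m : ℕ} (N : ℕ) (v w : SqSumSignal m) :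
    ‖tail N v - tail N w‖ ≤ ‖v - w‖ := by
  have e : tail N v - tail N w = tail N (v - w) := rfl
  rw [e]
  refine le_of_sq_le_sq ?_ (norm_nonneg _)
  rw [← (hasSum_norm_sq (v - w)).tsum_eq, ← (hasSum_norm_sq (tail N (v - w))).tsum_eq,
    ← (hasSum_norm_sq (v - w)).summable.sum_add_tsum_nat_add N]
  exact le_add_of_nonneg_left (Finset.sum_nonneg fun _ _ => by positivity)

theorem exists_glue {m : ℕ} (N : ℕ) (v : Signal m) (v₀ : SqSumSignal m) :
    ∃ vs : SqSumSignal m, (∀ t < N, v t = vs t) ∧ tail N vs = v₀ := by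
  refine ⟨⟨fun t => if t < N then v t else v₀ (t - N), ?_⟩, fun t ht => ?_, ?_⟩
  · refine (memℓp_two_iff _).2 ((summable_nat_add_iff N).1 ?_)
    simpa using (hasSum_norm_sq v₀).summable
  · exact (if_pos ht).symm
  · ext1
    funext t
    rw [tail_apply]
    simp

/-! ### Trajectories and the quadratic cost -/

section Cost

variable {n k q : ℕ} {A : Matrix (Fin n) (Fin n) ℝ} {B₁ : Matrix (Fin n) (Fin k) ℝ}
  {B₂ : Matrix (Fin n) (Fin q) ℝ}

theorem IsTrajectory.apply_succ {ξ : EuclideanSpace ℝ (Fin n)} {v : Signal k} {w : Signal q}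
    {x : Signal n} (hx : IsTrajectory A B₁ B₂ ξ v w x) (t : ℕ) (i : Fin n) :
    x (t + 1) i = ∑ j, A i j * x t j + ∑ j, B₁ i j * v t j + ∑ j, B₂ i j * w t j := by
  rw [hx.2 t]; rfl

theorem exists_isTrajectory (ξ : EuclideanSpace ℝ (Fin n)) (v : Signal k) (w : Signal q) :
    ∃ x, IsTrajectory A B₁ B₂ ξ v w x :=
  ⟨fun t => Nat.rec ξ (fun t x =>
    WithLp.toLp 2 (A *ᵥ x.ofLp + B₁ *ᵥ (v t).ofLp + B₂ *ᵥ (w t).ofLp)) t, rfl, fun _ => rfl⟩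

theorem IsTrajectory.eq_of_eq {ξ : EuclideanSpace ℝ (Fin n)} {v v' : Signal k} {w w' : Signal q}
    {x x' : Signal n} (hx : IsTrajectory A B₁ B₂ ξ v w x) (hx' : IsTrajectory A B₁ B₂ ξ v' w' x')
    {T : ℕ} (h : ∀ t < T, v t = v' t ∧ w t = w' t) : ∀ t ≤ T, x t = x' t := by
  intro t
  induction t with
  | zero => intro _; rw [hx.1, hx'.1]
  | succ t ih =>
    intro ht
    rw [hx.2, hx'.2, ih (by omega), (h t (by omega)).1, (h t (by omega)).2]

theorem IsTrajectory.tail {ξ : EuclideanSpace ℝ (Fin n)} {v : SqSumSignal k} {w : SqSumSignal q}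
    {x : Signal n} (hx : IsTrajectory A B₁ B₂ ξ v w x) (N : ℕ) :
    IsTrajectory A B₁ B₂ (x N) (tail N v) (tail N w) (fun t => x (t + N)) := by
  refine ⟨congrArg x (zero_add N), fun t => ?_⟩
  change x (t + 1 + N) = _
  rw [add_right_comm, hx.2]
  rfl

/-- The zero state response to the first input, with all its inputs. -/
noncomputable def response₁ (A : Matrix (Fin n) (Fin n) ℝ) (B₁ : Matrix (Fin n) (Fin k) ℝ)
    (B₂ : Matrix (Fin n) (Fin q) ℝ) : SqSumSignal k →L[ℝ] (Fin n ⊕ (Fin k ⊕ Fin q) → SeqHilbert) :=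
  ((polyAct (ioMatrix₁ A B₁ B₂)).comp (ContinuousLinearMap.pi fun j =>
    (invDen (toC A)).comp (ContinuousLinearMap.proj j))).restrictScalars ℝ ∘L coords k

/-- The zero state response to the second input, with all its inputs. -/
noncomputable def response₂ (A : Matrix (Fin n) (Fin n) ℝ) (B₁ : Matrix (Fin n) (Fin k) ℝ)
    (B₂ : Matrix (Fin n) (Fin q) ℝ) : SqSumSignal q →L[ℝ] (Fin n ⊕ (Fin k ⊕ Fin q) → SeqHilbert) :=
  ((polyAct (ioMatrix₂ A B₁ B₂)).comp (ContinuousLinearMap.pi fun j =>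
    (invDen (toC A)).comp (ContinuousLinearMap.proj j))).restrictScalars ℝ ∘L coords q

theorem response₁_apply (v : SqSumSignal k) : response₁ A B₁ B₂ v =
    polyAct (ioMatrix₁ A B₁ B₂) (fun j => invDen (toC A) (coords k v j)) := rfl

theorem response₂_apply (w : SqSumSignal q) : response₂ A B₁ B₂ w =
    polyAct (ioMatrix₂ A B₁ B₂) (fun j => invDen (toC A) (coords q w j)) := rfl

/-- The free response with zero inputs. -/
noncomputable def freeResponse₀ (k q : ℕ) (A : Matrix (Fin n) (Fin n) ℝ)
    (ξ : EuclideanSpace ℝ (Fin n)) :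
    Fin n ⊕ (Fin k ⊕ Fin q) → SeqHilbert :=
  Sum.elim (freeResponse (toC A) fun i => ((ξ i : ℝ) : ℂ)) 0

theorem fullResponse_inr_inl (hA : IsSchur A) (ξ : EuclideanSpace ℝ (Fin n)) (v : SqSumSignal k)
    (w : SqSumSignal q) (j : Fin k) :
    (freeResponse₀ k q A ξ + response₁ A B₁ B₂ v + response₂ A B₁ B₂ w) (Sum.inr (Sum.inl j)) =
      coords k v j := by
  rw [add_assoc, response₁_apply, response₂_apply, polyAct_ioMatrix_add, Pi.add_apply,
    response_inr hA]
  exact zero_add _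

theorem fullResponse_inr_inr (hA : IsSchur A) (ξ : EuclideanSpace ℝ (Fin n)) (v : SqSumSignal k)
    (w : SqSumSignal q) (j : Fin q) :
    (freeResponse₀ k q A ξ + response₁ A B₁ B₂ v + response₂ A B₁ B₂ w) (Sum.inr (Sum.inr j)) =
      coords q w j := by
  rw [add_assoc, response₁_apply, response₂_apply, polyAct_ioMatrix_add, Pi.add_apply,
    response_inr hA]
  exact zero_add _

theorem fullResponse_inl (hA : IsSchur A) {ξ : EuclideanSpace ℝ (Fin n)} {v : SqSumSignal k}
    {w : SqSumSignal q} {x : Signal n} (hx : IsTrajectory A B₁ B₂ ξ v w x) (i : Fin n) (t : ℕ) :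
    (freeResponse₀ k q A ξ + response₁ A B₁ B₂ v + response₂ A B₁ B₂ w) (Sum.inl i) t =
      ((x t i : ℝ) : ℂ) := by
  rw [add_assoc, response₁_apply, response₂_apply, polyAct_ioMatrix_add, Pi.add_apply,
    lp.coeFn_add, Pi.add_apply]
  change freeResponse (toC A) _ i t + _ = _
  induction t generalizing i with
  | zero =>
    rw [freeResponse_apply hA, response_inl_zero hA, hx.1]
    simp
  | succ t ih =>
    rw [response_inl_succ hA, hx.apply_succ, freeResponse_apply hA, pow_succ', ← mulVec_mulVec,
      Fintype.sum_sum_type]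
    push_cast
    have e : ∀ j, ((x t j : ℝ) : ℂ) = (toC A ^ t *ᵥ fun i => ((ξ i : ℝ) : ℂ)) j +
        response (toC A) (toC (fromCols B₁ B₂)) (Sum.elim (coords k v) (coords q w))
          (Sum.inl j) t := fun j => by rw [← ih j, freeResponse_apply hA]
    simp only [e, mul_add, Finset.sum_add_distrib, Sum.elim_inl, Sum.elim_inr, coords_apply]
    simp only [mulVec, dotProduct, toC, map_apply, fromCols_apply_inl, fromCols_apply_inr]
    ring

/-- The symmetric real bilinear form of the cost. -/
noncomputable def costForm (Q : Matrix (Fin n ⊕ (Fin k ⊕ Fin q)) (Fin n ⊕ (Fin k ⊕ Fin q)) ℝ) :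
    (Fin n ⊕ (Fin k ⊕ Fin q) → SeqHilbert) →ₗ[ℝ]
      (Fin n ⊕ (Fin k ⊕ Fin q) → SeqHilbert) →ₗ[ℝ] ℝ :=
  have hadd : ∀ y₁ y₂ y, sesq (toC Q) (y₁ + y₂) y = sesq (toC Q) y₁ y + sesq (toC Q) y₂ y :=
    fun y₁ y₂ y => by
      simp only [sesq_apply, Pi.add_apply, inner_add_left, mul_add, Finset.sum_add_distrib]
  have hsmul : ∀ (c : ℝ) y₁ y, sesq (toC Q) (c • y₁) y = c * sesq (toC Q) y₁ y :=
    fun c y₁ y => by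
      simp only [sesq_apply, Pi.smul_apply, real_smul_seqHilbert, inner_smul_left,
        Complex.conj_ofReal, Finset.mul_sum]
      exact Finset.sum_congr rfl fun i _ => Finset.sum_congr rfl fun j _ => by ring
  have hsmul' : ∀ (c : ℝ) y₁ y, sesq (toC Q) y₁ (c • y) = c * sesq (toC Q) y₁ y :=
    fun c y₁ y => by
      simp only [sesq_apply, Pi.smul_apply, real_smul_seqHilbert, inner_smul_right, Finset.mul_sum]
      exact Finset.sum_congr rfl fun i _ => Finset.sum_congr rfl fun j _ => by ring
  LinearMap.mk₂ ℝ (fun y y' => ((sesq (toC Q) y y').re + (sesq (toC Q) y' y).re) / 2)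
    (fun y₁ y₂ y => by rw [hadd, map_add, Complex.add_re, Complex.add_re]; ring)
    (fun c y₁ y => by
      rw [hsmul, hsmul', smul_eq_mul, Complex.re_ofReal_mul,
        Complex.re_ofReal_mul]
      ring)
    (fun y y₁ y₂ => by rw [hadd, map_add, Complex.add_re, Complex.add_re]; ring)
    (fun c y₁ y => by
      rw [hsmul, hsmul', smul_eq_mul, Complex.re_ofReal_mul,
        Complex.re_ofReal_mul]
      ring)

variable {Q : Matrix (Fin n ⊕ (Fin k ⊕ Fin q)) (Fin n ⊕ (Fin k ⊕ Fin q)) ℝ}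

theorem costForm_apply (y y' : Fin n ⊕ (Fin k ⊕ Fin q) → SeqHilbert) :
    costForm Q y y' = ((sesq (toC Q) y y').re + (sesq (toC Q) y' y).re) / 2 := rfl

theorem costForm_self (y : Fin n ⊕ (Fin k ⊕ Fin q) → SeqHilbert) :
    costForm Q y y = (sesq (toC Q) y y).re := by
  rw [costForm_apply]; ring

theorem hasSum_quadForm (hA : IsSchur A) {ξ : EuclideanSpace ℝ (Fin n)} {v : SqSumSignal k}
    {w : SqSumSignal q} {x : Signal n} (hx : IsTrajectory A B₁ B₂ ξ v w x) :
    HasSum (fun t => quadForm Q (x t) (v t) (w t))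
      (costForm Q (freeResponse₀ k q A ξ + response₁ A B₁ B₂ v + response₂ A B₁ B₂ w)
        (freeResponse₀ k q A ξ + response₁ A B₁ B₂ v + response₂ A B₁ B₂ w)) := by
  have hy : ∀ j t, (freeResponse₀ k q A ξ + response₁ A B₁ B₂ v + response₂ A B₁ B₂ w) j t =
      ((Sum.elim (x t).ofLp (Sum.elim (v t).ofLp (w t).ofLp) j : ℝ) : ℂ) := by
    rintro (i | i | i) t
    · exact fullResponse_inl hA hx i t
    · rw [fullResponse_inr_inl hA]; rfl
    · rw [fullResponse_inr_inr hA]; rfl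
  rw [costForm_self, sesq_apply]
  have h := Complex.hasSum_re (hasSum_sum fun i (_ : i ∈ Finset.univ) =>
    hasSum_sum fun j (_ : j ∈ Finset.univ) => (lp.hasSum_inner (𝕜 := ℂ)
      ((freeResponse₀ k q A ξ + response₁ A B₁ B₂ v + response₂ A B₁ B₂ w) i)
      ((freeResponse₀ k q A ξ + response₁ A B₁ B₂ v + response₂ A B₁ B₂ w) j)).mul_left
        (toC Q i j))
  convert h using 1
  funext t
  simp only [hy, Complex.re_sum]
  rw [quadForm, dotProduct]
  refine Finset.sum_congr rfl fun i _ => ?_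
  rw [mulVec, dotProduct, Finset.mul_sum]
  refine Finset.sum_congr rfl fun j _ => ?_
  rw [RCLike.inner_apply, Complex.conj_ofReal]
  simp only [toC, map_apply]
  norm_cast
  ring

end Cost

/-! ### The minimax property of the cost and the main theorem -/

section Main

variable {n k q : ℕ} {A : Matrix (Fin n) (Fin n) ℝ} {B₁ : Matrix (Fin n) (Fin k) ℝ}
  {B₂ : Matrix (Fin n) (Fin q) ℝ}
  {Q : Matrix (Fin n ⊕ (Fin k ⊕ Fin q)) (Fin n ⊕ (Fin k ⊕ Fin q)) ℝ}

theorem sum_smul_apply {m : ℕ} (c : Fin m → ℝ) (y : Fin m → SeqHilbert) (t : ℕ) :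
    (∑ j, ((c j : ℝ) : ℂ) • y j) t = ∑ j, ((c j : ℝ) : ℂ) * y j t := by
  rw [seqHilbert_sum_apply]; rfl

/-- For every second input there is a first input with small cost. -/
theorem exists_cost_le (hA : IsSchur A) {E : Matrix (Fin k) (Fin n) ℝ}
    {D₁ : Matrix (Fin k) (Fin k) ℝ} {D₂ : Matrix (Fin k) (Fin q) ℝ}
    (hle : ∀ (x : EuclideanSpace ℝ (Fin n)) (v : EuclideanSpace ℝ (Fin k))
      (w : EuclideanSpace ℝ (Fin q)), quadForm Q x v w ≤
        ‖(WithLp.toLp 2 (E *ᵥ x.ofLp + D₁ *ᵥ v.ofLp + D₂ *ᵥ w.ofLp) :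
          EuclideanSpace ℝ (Fin k))‖ ^ 2)
    (hmp : MinimumPhase A B₁ E D₁) (ξ : EuclideanSpace ℝ (Fin n)) (w : SqSumSignal q) {δ : ℝ}
    (hδ : 0 < δ) : ∃ v, costForm Q
      (freeResponse₀ k q A ξ + response₁ A B₁ B₂ v + response₂ A B₁ B₂ w)
      (freeResponse₀ k q A ξ + response₁ A B₁ B₂ v + response₂ A B₁ B₂ w) ≤ δ := by
  obtain ⟨x₀, hx₀⟩ := exists_isTrajectory (A := A) (B₁ := B₁) (B₂ := B₂) ξ
    ((0 : SqSumSignal k) : Signal k) w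
  set y := freeResponse₀ k q A ξ + response₁ A B₁ B₂ 0 + response₂ A B₁ B₂ w with hy
  have hyx : ∀ i t, y (Sum.inl i) t = ((x₀ t i : ℝ) : ℂ) := fullResponse_inl hA hx₀
  -- The output under zero first input; the correction by `u` from zero initial state is chosen
  -- nearly to cancel it.
  let g : Fin k → SeqHilbert := fun i =>
    ∑ j, ((E i j : ℝ) : ℂ) • y (Sum.inl j) + ∑ j, ((D₂ i j : ℝ) : ℂ) • coord w j
  have hδ' : 0 < √(δ / (k + 1)) := by positivity
  obtain ⟨X, u, hX, hXu⟩ := exists_approx_output (toC A) (toC B₁) (toC E) (toC D₁) hmp g hδ'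
  let x : Signal n := fun t => x₀ t + WithLp.toLp 2 fun i => (X i t).re
  have hxi : ∀ t i, x t i = x₀ t i + (X i t).re := fun _ _ => rfl
  have hXsucc : ∀ i t, X i (t + 1) =
      ∑ j, ((A i j : ℝ) : ℂ) * X j t + ∑ j, ((B₁ i j : ℝ) : ℂ) * u j t := by
    intro i t
    rw [hX, shift_succ, lp.coeFn_add, Pi.add_apply, ← sum_smul_apply, ← sum_smul_apply]
    rfl
  -- The correcting input is complex, but all matrices are real, so real parts again satisfy the
  -- state equation and do not enlarge the output.
  have hx : IsTrajectory A B₁ B₂ ξ (realPart u) w x := by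
    refine ⟨?_, fun t => ?_⟩
    · ext i
      rw [hxi, hx₀.1, hX, shift_zero]
      simp
    · ext i
      rw [hxi, hx₀.apply_succ, hXsucc]
      simp only [Complex.add_re, Complex.re_sum, Complex.re_ofReal_mul]
      simp only [Pi.add_apply, mulVec, dotProduct, hxi, realPart_apply, mul_add,
        Finset.sum_add_distrib]
      simp
      ring
  refine ⟨realPart u, ?_⟩
  let G : Fin k → SeqHilbert := fun i =>
    g i + (∑ j, toC E i j • X j + ∑ j, toC D₁ i j • u j)
  have hG : ∀ i t, (G i t).re =
      (E *ᵥ (x t).ofLp + D₁ *ᵥ (realPart u t).ofLp + D₂ *ᵥ (w t).ofLp) i := by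
    intro i t
    have e : G i t = (∑ j, ((E i j : ℝ) : ℂ) * y (Sum.inl j) t
        + ∑ j, ((D₂ i j : ℝ) : ℂ) * coord w j t)
        + (∑ j, ((E i j : ℝ) : ℂ) * X j t + ∑ j, ((D₁ i j : ℝ) : ℂ) * u j t) := by
      rw [← sum_smul_apply, ← sum_smul_apply, ← sum_smul_apply, ← sum_smul_apply]
      rfl
    rw [e]
    simp only [Complex.add_re, Complex.re_sum, Complex.re_ofReal_mul, hyx, coord_apply,
      Complex.ofReal_re]
    simp only [Pi.add_apply, mulVec, dotProduct, hxi, realPart_apply, mul_add,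
      Finset.sum_add_distrib]
    ring
  have hle' : ∀ t, quadForm Q (x t) (realPart u t) (w t) ≤ ∑ i, ‖G i t‖ ^ 2 := by
    intro t
    refine (hle _ _ _).trans ?_
    rw [norm_sq_eq_sum_of_euclidean]
    refine Finset.sum_le_sum fun i _ => ?_
    change (E *ᵥ (x t).ofLp + D₁ *ᵥ (realPart u t).ofLp + D₂ *ᵥ (w t).ofLp) i ^ 2 ≤ _
    rw [← hG]
    exact sq_le_sq' (neg_le_of_abs_le (Complex.abs_re_le_norm _)) (Complex.re_le_norm _)
  refine (hasSum_le hle' (hasSum_quadForm hA hx)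
    (hasSum_sum fun i (_ : i ∈ Finset.univ) => hasSum_norm_sq (G i))).trans ?_
  have h1 : ∀ i ∈ Finset.univ, ‖G i‖ ^ 2 ≤ δ / (k + 1) := by
    intro i _
    rw [← Real.sq_sqrt (by positivity : 0 ≤ δ / (k + 1))]
    gcongr
    exact (hXu i).le
  refine (Finset.sum_le_sum h1).trans ?_
  rw [Finset.sum_const, Finset.card_univ, Fintype.card_fin, nsmul_eq_mul, mul_div_assoc',
    div_le_iff₀ (by positivity)]
  nlinarith

/-- The minimax property of the cost: from every initial state there is a first input, which may be
perturbed, that keeps the cost small whatever the second input is. -/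
theorem exists_robust_input (hA : IsSchur A)
    (hfreq : ∃ ε : ℝ, 0 < ε ∧ ∃ z₀ : ℂ, ‖z₀‖ = 1 ∧ MinimaxFrequencyCondition A B₁ B₂ Q ε z₀)
    {E : Matrix (Fin k) (Fin n) ℝ} {D₁ : Matrix (Fin k) (Fin k) ℝ} {D₂ : Matrix (Fin k) (Fin q) ℝ}
    (hle : ∀ (x : EuclideanSpace ℝ (Fin n)) (v : EuclideanSpace ℝ (Fin k))
      (w : EuclideanSpace ℝ (Fin q)), quadForm Q x v w ≤
        ‖(WithLp.toLp 2 (E *ᵥ x.ofLp + D₁ *ᵥ v.ofLp + D₂ *ᵥ w.ofLp) :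
          EuclideanSpace ℝ (Fin k))‖ ^ 2)
    (hmp : MinimumPhase A B₁ E D₁) (ξ : EuclideanSpace ℝ (Fin n)) {δ : ℝ} (hδ : 0 < δ) :
    ∃ v₀ : SqSumSignal k, ∀ᶠ v : SqSumSignal k in 𝓝 v₀, ∀ (w : SqSumSignal q) (x : Signal n),
      IsTrajectory A B₁ B₂ ξ v w x → ∑' t, quadForm Q (x t) (v t) (w t) ≤ δ := by
  obtain ⟨ε, hε, z₀, hz₀, hcond⟩ := hfreq
  obtain ⟨hblocks, hpd₁, hpd₂⟩ := ioMatrix_blocks_posSemidef B₁ B₂ hA Q hz₀ hcond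
  have hz₀' : ‖z₀⁻¹‖ = 1 := by rw [norm_inv, hz₀, inv_one]
  have hneg : ∀ l : ℂ, ((ioMatrix₂ A B₁ B₂).map (eval l))ᴴ * (-toC Q) *
      (ioMatrix₂ A B₁ B₂).map (eval l) =
      -(((ioMatrix₂ A B₁ B₂).map (eval l))ᴴ * toC Q * (ioMatrix₂ A B₁ B₂).map (eval l)) :=
    fun l => by rw [Matrix.mul_neg, Matrix.neg_mul]
  have hsneg : ∀ y y', sesq (-toC Q) y y' = -sesq (toC Q) y y' := fun y y' => by
    simp only [sesq_apply, Matrix.neg_apply, neg_mul, Finset.sum_neg_distrib]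
  obtain ⟨ha, K₁, hK₁, hl₁⟩ := exists_bound_of_posSemidef hA (ioMatrix₁ A B₁ B₂) (toC Q)
    (fun l hl => (hblocks l hl).submatrix Sum.inl) hz₀' hpd₁ (fun i => ((ξ i : ℝ) : ℂ))
  obtain ⟨hb, K₂, hK₂, hl₂⟩ := exists_bound_of_posSemidef hA (ioMatrix₂ A B₁ B₂) (-toC Q)
    (fun l hl => by rw [hneg]; exact (hblocks l hl).submatrix Sum.inr) hz₀'
    (by rw [hneg]; exact hpd₂) (fun i => ((ξ i : ℝ) : ℂ))
  have hr := re_sesq_blocks_nonneg (ioMatrix₁ A B₁ B₂) (ioMatrix₂ A B₁ B₂) (toC Q) ε hblocks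
  -- One constant dominating the two linear terms and the cross term.
  have hK : √(K₁ + K₂ + ε⁻¹ ^ 2) ^ 2 = K₁ + K₂ + ε⁻¹ ^ 2 := Real.sq_sqrt (by positivity)
  have ha' : ∀ v, 0 ≤ costForm Q (response₁ A B₁ B₂ v) (response₁ A B₁ B₂ v) := fun v => by
    rw [costForm_self]; exact ha _
  have hb' : ∀ w, 0 ≤ -costForm Q (response₂ A B₁ B₂ w) (response₂ A B₁ B₂ w) := fun w => by
    have h := hb fun j => invDen (toC A) (coords q w j)
    rw [hsneg, Complex.neg_re] at h
    rw [costForm_self]; exact h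
  obtain ⟨v₀, η, hη, hv₀⟩ := exists_forall_quadratic_le (costForm Q)
    (fun x y => by rw [costForm_apply, costForm_apply, add_comm])
    (response₁ A B₁ B₂ : SqSumSignal k →ₗ[ℝ] _) (response₂ A B₁ B₂ : SqSumSignal q →ₗ[ℝ] _)
    (freeResponse₀ k q A ξ) (√(K₁ + K₂ + ε⁻¹ ^ 2)) (Real.sqrt_nonneg _) ha' hb'
    (fun v w => by
      -- Scaling `v` by `t` turns the block inequality into a nonnegative quadratic in `t`; its
      -- discriminant bounds the cross term with factor `ε⁻²`.
      have h : ∀ t : ℝ, 0 ≤ costForm Q (response₁ A B₁ B₂ v) (response₁ A B₁ B₂ v) * (t * t)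
          + 2 * ε * costForm Q (response₁ A B₁ B₂ v) (response₂ A B₁ B₂ w) * t
          + -costForm Q (response₂ A B₁ B₂ w) (response₂ A B₁ B₂ w) := by
        intro t
        have h1 := hr (fun j => invDen (toC A) (coords k (t • v) j))
          (fun j => invDen (toC A) (coords q w j))
        rw [← response₁_apply, ← response₂_apply, ← costForm_self, ← costForm_self] at h1
        have h2 : (sesq (toC Q) (response₁ A B₁ B₂ (t • v)) (response₂ A B₁ B₂ w)).re
            + (sesq (toC Q) (response₂ A B₁ B₂ w) (response₁ A B₁ B₂ (t • v))).re =
            2 * costForm Q (response₁ A B₁ B₂ (t • v)) (response₂ A B₁ B₂ w) := by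
          rw [costForm_apply]; ring
        rw [h2] at h1
        simp only [map_smul, LinearMap.smul_apply, smul_eq_mul] at h1
        linarith
      have h3 := discrim_le_zero h
      rw [discrim] at h3
      rw [hK]
      have h4 := mul_nonneg (ha' v) (hb' w)
      simp only [ContinuousLinearMap.coe_coe]
      set a := costForm Q (response₁ A B₁ B₂ v) (response₁ A B₁ B₂ v)
      set b := costForm Q (response₂ A B₁ B₂ w) (response₂ A B₁ B₂ w)
      set r := costForm Q (response₁ A B₁ B₂ v) (response₂ A B₁ B₂ w)
      have h5 : ε ^ 2 * r ^ 2 ≤ a * -b := by linarith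
      calc r ^ 2 = ε⁻¹ ^ 2 * (ε ^ 2 * r ^ 2) := by field_simp
        _ ≤ ε⁻¹ ^ 2 * (a * -b) := by gcongr
        _ ≤ _ := mul_le_mul_of_nonneg_right (by linarith) h4)
    (fun v => by
      have h := hl₁ fun j => invDen (toC A) (coords k v j)
      rw [← response₁_apply, ← costForm_self] at h
      have h2 := mul_nonneg hK₁ (ha' v)
      have h3 := mul_nonneg (by positivity : 0 ≤ K₂ + ε⁻¹ ^ 2) (ha' v)
      rw [hK]
      simp only [ContinuousLinearMap.coe_coe]
      rw [costForm_apply (freeResponse₀ k q A ξ), div_pow, freeResponse₀]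
      linarith)
    (fun w => by
      have h := hl₂ fun j => invDen (toC A) (coords q w j)
      rw [← response₂_apply] at h
      simp only [hsneg, Complex.neg_re] at h
      rw [← costForm_self] at h
      have h2 := mul_nonneg hK₂ (hb' w)
      have h3 := mul_nonneg (by positivity : 0 ≤ K₁ + ε⁻¹ ^ 2) (hb' w)
      rw [hK]
      simp only [ContinuousLinearMap.coe_coe]
      rw [costForm_apply (freeResponse₀ k q A ξ), div_pow, freeResponse₀]
      linarith)
    (fun w δ hδ => exists_cost_le hA hle hmp ξ w hδ) hδ
  -- The seminorm is continuous in the `ℓ²` norm, so the admissible perturbations contain an `ℓ²`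
  -- neighbourhood of `v₀`.
  have hcont : Continuous fun v => costForm Q (response₁ A B₁ B₂ (v - v₀))
      (response₁ A B₁ B₂ (v - v₀)) := by
    simp only [costForm_self, sesq_apply]
    fun_prop
  have hev := hcont.continuousAt.eventually_lt (x₀ := v₀) continuousAt_const
    (show costForm Q (response₁ A B₁ B₂ (v₀ - v₀)) (response₁ A B₁ B₂ (v₀ - v₀)) < η by simpa)
  refine ⟨v₀, hev.mono fun v hv w x hx => ?_⟩
  rw [(hasSum_quadForm hA hx).tsum_eq]
  exact hv₀ v hv.le w

end Main

end DTIQC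

theorem mainTheorem5 {n k q : ℕ} (Δ : DTIQC.DTSystem k q)
    (A : Matrix (Fin n) (Fin n) ℝ) (B₁ : Matrix (Fin n) (Fin k) ℝ) (B₂ : Matrix (Fin n) (Fin q) ℝ)
    (Q : Matrix (Fin n ⊕ (Fin k ⊕ Fin q)) (Fin n ⊕ (Fin k ⊕ Fin q)) ℝ)
    (X₀ : Set (EuclideanSpace ℝ (Fin n)))
    (hA : DTIQC.IsSchur A)
    (hΔ : DTIQC.WeaklyCausallyStable Δ)
    (hcond : DTIQC.ConditionalIQC Δ A B₁ B₂ Q X₀)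
    (hfreq : ∃ ε : ℝ, 0 < ε ∧ ∃ z₀ : ℂ, ‖z₀‖ = 1 ∧
      DTIQC.MinimaxFrequencyCondition A B₁ B₂ Q ε z₀)
    (hsq : ∃ (C : Matrix (Fin k) (Fin n) ℝ) (D₁ : Matrix (Fin k) (Fin k) ℝ)
        (D₂ : Matrix (Fin k) (Fin q) ℝ),
      (∀ (x : EuclideanSpace ℝ (Fin n)) (v : EuclideanSpace ℝ (Fin k))
          (w : EuclideanSpace ℝ (Fin q)),
        DTIQC.quadForm Q x v w ≤
          ‖(WithLp.toLp 2 (C.mulVec x.ofLp + D₁.mulVec v.ofLp + D₂.mulVec w.ofLp) :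
            EuclideanSpace ℝ (Fin k))‖ ^ 2) ∧
      DTIQC.MinimumPhase A B₁ C D₁) :
    DTIQC.CompleteIQC Δ A B₁ B₂ Q X₀ := by
  obtain ⟨C, D₁, D₂, hle, hmp⟩ := hsq
  obtain ⟨κ, hκ, hiqc⟩ := hcond
  refine ⟨κ, hκ, fun v w hvw x₀ hx₀ x hx T => ?_⟩
  refine le_of_forall_pos_le_add fun δ hδ => ?_
  obtain ⟨v₀, hv₀⟩ := DTIQC.exists_robust_input hA hfreq hle hmp (x (T + 1)) hδ
  -- The past is kept for times `0, …, T`, exactly the window of weak causal stability; the robust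
  -- input starts at `T + 1`.
  obtain ⟨vs, hvs, htail⟩ := DTIQC.exists_glue (T + 1) v v₀
  obtain ⟨vi, wi, hmem, hagree, hlim⟩ :=
    hΔ T v w hvw vs fun t ht => hvs t (Nat.lt_succ_of_le ht)
  have hlim' : Tendsto (fun i => DTIQC.tail (T + 1) (vi i)) atTop (𝓝 v₀) := by
    rw [tendsto_iff_norm_sub_tendsto_zero]
    refine squeeze_zero (fun _ => norm_nonneg _) (fun i => ?_) hlim
    rw [← htail]
    exact DTIQC.norm_tail_sub_le _ _ _
  obtain ⟨i, hi⟩ := (hlim'.eventually hv₀).exists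
  obtain ⟨xi, hxi⟩ := DTIQC.exists_isTrajectory (A := A) (B₁ := B₁) (B₂ := B₂) x₀
    (vi i : DTIQC.Signal k) (wi i)
  have heq := hxi.eq_of_eq hx (T := T + 1) fun t ht => hagree i t (Nat.le_of_lt_succ ht)
  have h1 := hiqc (vi i) (wi i) (hmem i) x₀ hx₀ xi hxi
  -- Agreement at time `0` keeps the argument of `κ` unchanged, while the tail sum is the cost of a
  -- trajectory restarted from `x (T + 1)`.
  rw [← (DTIQC.hasSum_quadForm hA hxi).summable.sum_add_tsum_nat_add (T + 1),
    (hagree i 0 (Nat.zero_le T)).1, (hagree i 0 (Nat.zero_le T)).2] at h1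
  have h2 := hi (DTIQC.tail (T + 1) (wi i)) _ (by
    rw [← heq (T + 1) le_rfl]
    exact hxi.tail (T + 1))
  have h3 : ∑ t ∈ Finset.range (T + 1), DTIQC.quadForm Q (xi t) (vi i t) (wi i t) =
      ∑ t ∈ Finset.range (T + 1), DTIQC.quadForm Q (x t) (v t) (w t) := by
    refine Finset.sum_congr rfl fun t ht => ?_
    have ht' := Finset.mem_range.1 ht
    rw [heq t ht'.le, (hagree i t (Nat.le_of_lt_succ ht')).1,
      (hagree i t (Nat.le_of_lt_succ ht')).2]
  rw [h3] at h1
  exact h1.le.trans (add_le_add_right h2 _)
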